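/- Let $d\ge 1$ and let $\mathfrak A=\overline{\bigotimes_{\mathbb Z}M_d(\mathbb C)}$ be the UHF $C^*$-algebra of quasi-local observables of a quantum spin chain. For $\Lambda\subset\mathbb Z$ let $\mathfrak A_\Lambda$ be the $C^*$-subalgebra generated by the one-site operators $Q^{(j)}$ with $j\in\Lambda$. Let $\varphi$ be a state of $\mathfrak A$ with GNS triple $(\pi_\varphi,\mathfrak H_\varphi,\Omega_\varphi)$, and let $P_0=|\Omega_\varphi\rangle\langle\Omega_\varphi|$. For finite $\Lambda$ let $s(\varphi_\Lambda)=-\mathrm{tr}(\rho_\Lambda\ln\rho_\Lambda)$, where $\rho_\Lambda$ is the density matrix of the restriction $\varphi_\Lambda=\varphi|_{\mathfrak A_\Lambda}$. Suppose that there are constants $C_1,C_2>0$ such that for every $m\in\mathbb Z$ and all integers $n,l$ with $1\le l<n/8$ there are projections $O_R,O_L$ and an operator $O_B$ on $\mathfrak H_\varphi$ (depending on $m,n,l$) such that, with $I=[m,m+n-1]\cap\mathbb Z$, $$O_R\in\pi_\varphi(\mathfrak A_{I}),\qquad O_L\in\pi_\varphi(\mathfrak A_{\mathbb Z\setminus I})'',\qquad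 O_B\in\pi_\varphi(\mathfrak A_{(m-l,\,m+l)\cup(m+n-l,\,m+n+l)}),\qquad 0\le O_B\le 1,$$ $$\|O_BO_RO_L-P_0\|\le C_1e^{-C_2l},$$ where the open intervals are intervals of integers. Then the entanglement entropy of $\varphi$ is bounded: there is $S<\infty$ with $s(\varphi_{[a,b]})\le S$ for all integers $a,b$. In particular $\sup_{n}s(\varphi_{[1,n]})<\infty$. -/

import Mathlib

open scoped ComplexOrder InnerProductSpace

noncomputable section

namespace SpinChain

/-- Configurations of a spin chain on `ℤ` with `d` levels per site which differ from the
constant configuration `0` at finitely many sites only. -/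
abbrev Config (d : ℕ) [NeZero d] : Type := ℤ →₀ Fin d

/-- The Hilbert space with orthonormal basis indexed by `Config d`, that is, the incomplete
infinite tensor product of the one-site spaces `ℂ^d` along the reference vector `e_0`.
It carries a faithful representation of the infinite tensor product of matrix algebras. -/
abbrev ConfigSpace (d : ℕ) [NeZero d] : Type := lp (fun _ : Config d => ℂ) 2

/-- The coefficients of `|a⟩⟨b|` (acting on site `j`) applied to `f`. -/
def unitFun {d : ℕ} [NeZero d] (j : ℤ) (a b : Fin d) (f : Config d → ℂ) (σ : Config d) : ℂ :=
  if σ j = a then f (σ.update j b) else 0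

theorem sum_unitFun_le {d : ℕ} [NeZero d] (j : ℤ) (a b : Fin d) (f : ConfigSpace d)
    (s : Finset (Config d)) :
    ∑ σ ∈ s, ‖unitFun j a b (⇑f) σ‖ ^ (2 : ENNReal).toReal ≤ ‖f‖ ^ (2 : ENNReal).toReal := by
  classical
  have h1 : ∑ σ ∈ s, ‖unitFun j a b (⇑f) σ‖ ^ (2 : ENNReal).toReal
      = ∑ σ ∈ s with σ j = a, ‖f (σ.update j b)‖ ^ (2 : ENNReal).toReal := by
    rw [Finset.sum_filter]
    refine Finset.sum_congr rfl fun σ _ => ?_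
    by_cases h : σ j = a <;> simp [unitFun, h]
  have hinj : Set.InjOn (fun σ : Config d => σ.update j b)
      (↑(s.filter fun σ => σ j = a) : Set (Config d)) := by
    intro σ hσ τ hτ h
    have hσ' : σ j = a := (Finset.mem_filter.mp (Finset.mem_coe.mp hσ)).2
    have hτ' : τ j = a := (Finset.mem_filter.mp (Finset.mem_coe.mp hτ)).2
    ext k
    by_cases hk : k = j
    · subst hk; rw [hσ', hτ']
    · have := DFunLike.congr_fun h k
      simp [Function.update_of_ne hk] at this
      rw [this]
  rw [h1, ← Finset.sum_image (f := fun τ => ‖f τ‖ ^ (2 : ENNReal).toReal) hinj]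
  exact lp.sum_rpow_le_norm_rpow (by norm_num) f _

/-- The matrix unit `|a⟩⟨b|` at site `j`, tensored with the identity at all other sites. -/
def siteUnitOp {d : ℕ} [NeZero d] (j : ℤ) (a b : Fin d) :
    ConfigSpace d →L[ℂ] ConfigSpace d :=
  LinearMap.mkContinuous
    { toFun := fun f => ⟨unitFun j a b (⇑f), memℓp_gen' (sum_unitFun_le j a b f)⟩
      map_add' := fun f g => by
        ext σ
        change unitFun j a b (⇑(f + g)) σ = unitFun j a b (⇑f) σ + unitFun j a b (⇑g) σ
        by_cases h : σ j = a <;> simp [unitFun, h]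
      map_smul' := fun c f => by
        ext σ
        by_cases h : σ j = a <;> simp [unitFun, h] }
    1 fun f => by
      rw [one_mul]
      exact lp.norm_le_of_forall_sum_le (by norm_num) (norm_nonneg f) (sum_unitFun_le j a b f)

/-- `Q^{(j)}`: the matrix `Q` at site `j`, the identity at all other sites. -/
def siteOp {d : ℕ} [NeZero d] (j : ℤ) (Q : Matrix (Fin d) (Fin d) ℂ) :
    ConfigSpace d →L[ℂ] ConfigSpace d :=
  ∑ a, ∑ b, Q a b • siteUnitOp j a b

/-- The C⋆-algebra of quasi-local observables as a concrete C⋆-algebra of operators: the norm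
closure of the ⋆-algebra generated by all `Q^{(j)}`. -/
def quasiLocal (d : ℕ) [NeZero d] :
    StarSubalgebra ℂ (ConfigSpace d →L[ℂ] ConfigSpace d) :=
  (StarAlgebra.adjoin ℂ {T | ∃ j Q, T = siteOp j Q}).topologicalClosure

/-- The UHF algebra `⨂_ℤ M_d(ℂ)` of quasi-local observables. -/
def Obs (d : ℕ) [NeZero d] : Type := quasiLocal d

instance instCStarAlgebraObs (d : ℕ) [NeZero d] : CStarAlgebra (Obs d) :=
  haveI : IsClosed (quasiLocal d : Set (ConfigSpace d →L[ℂ] ConfigSpace d)) :=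
    StarSubalgebra.isClosed_topologicalClosure _
  inferInstanceAs (CStarAlgebra (quasiLocal d))

/-- The usual order of a C⋆-algebra: `x ≤ y` iff `y - x` is selfadjoint with spectrum in
`[0, ∞)`. -/
instance instPartialOrderObs (d : ℕ) [NeZero d] : PartialOrder (Obs d) :=
  CStarAlgebra.spectralOrder (Obs d)

instance instStarOrderedRingObs (d : ℕ) [NeZero d] : StarOrderedRing (Obs d) :=
  CStarAlgebra.spectralOrderedRing (Obs d)

/-- `Q^{(j)}` as an element of the algebra of observables. -/
def site {d : ℕ} [NeZero d] (j : ℤ) (Q : Matrix (Fin d) (Fin d) ℂ) : Obs d :=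
  (⟨siteOp j Q, subset_closure (StarAlgebra.subset_adjoin ℂ _ ⟨j, Q, rfl⟩)⟩ : quasiLocal d)

/-- `𝔄_Λ`: the C⋆-subalgebra generated by the `Q^{(j)}` with `j ∈ Λ`. -/
def localAlg (d : ℕ) [NeZero d] (Λ : Set ℤ) : StarSubalgebra ℂ (Obs d) :=
  (StarAlgebra.adjoin ℂ {x : Obs d | ∃ j ∈ Λ, ∃ Q, x = site j Q}).topologicalClosure

/-- A state: a normalized positive linear functional. -/
structure State (d : ℕ) [NeZero d] where
  /-- the underlying positive linear functional -/
  toPos : Obs d →ₚ[ℂ] ℂ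
  map_one' : toPos 1 = 1

/-- For a finite set `Λ` of sites, the matrix unit `|s⟩⟨t|` of `𝔄_Λ ≅ M_{d^|Λ|}(ℂ)`, i.e. the
product of the (commuting) one-site matrix units `|s j⟩⟨t j|` over `j ∈ Λ`. -/
def matUnit {d : ℕ} [NeZero d] (Λ : Finset ℤ) (s t : Λ → Fin d) : Obs d :=
  (((Finset.univ : Finset Λ).sort (· ≤ ·)).map
    fun j : Λ => site (j : ℤ) (Matrix.single (s j) (t j) 1)).prod

namespace State

variable {d : ℕ} [NeZero d] (φ : State d)

/-- The density matrix `ρ` of the restriction `φ_Λ`, so that `φ Q = tr (ρ Q)` on `𝔄_Λ`;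
its `(s, t)` entry is `tr (ρ |t⟩⟨s|)`. -/
def density (Λ : Finset ℤ) : Matrix (Λ → Fin d) (Λ → Fin d) ℂ :=
  Matrix.of fun s t => φ.toPos (matUnit Λ t s)

/-- The von Neumann entropy `s(φ_Λ) = - tr (ρ ln ρ)`; here `Real.negMulLog x = - x * log x`
is applied to `ρ` by functional calculus. -/
def entropy (Λ : Finset ℤ) : ℝ :=
  (Matrix.trace (cfc Real.negMulLog (φ.density Λ))).re

/-- The GNS Hilbert space. -/
abbrev gnsSpace : Type := φ.toPos.GNS

/-- The GNS representation. -/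
abbrev gnsRep : Obs d →⋆ₐ[ℂ] (φ.gnsSpace →L[ℂ] φ.gnsSpace) := φ.toPos.gnsStarAlgHom

/-- The GNS cyclic vector `Ω`, i.e. the class of `1`. -/
def gnsVec : φ.gnsSpace := ((φ.toPos.toPreGNS 1 : φ.toPos.PreGNS) : φ.gnsSpace)

/-- The rank one operator `P₀ = |Ω⟩⟨Ω|`. -/
def groundProj : φ.gnsSpace →L[ℂ] φ.gnsSpace :=
  InnerProductSpace.rankOne ℂ φ.gnsVec φ.gnsVec

/-- `π_φ(𝔄_Λ)`. -/
def repLocal (Λ : Set ℤ) : Set (φ.gnsSpace →L[ℂ] φ.gnsSpace) :=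
  φ.gnsRep '' (localAlg d Λ : Set (Obs d))

/-- The von Neumann algebra `π_φ(𝔄_Λ)''`. -/
def repVN (Λ : Set ℤ) : Set (φ.gnsSpace →L[ℂ] φ.gnsSpace) :=
  Set.centralizer (Set.centralizer (φ.repLocal Λ))

end State

end SpinChain

end

/-!
The proof follows Hastings' area law argument. Write `Ω` for the GNS vector, and for a finite
interval `I` let `ρ_I` be the density matrix of the restriction of the state to `I`. The hypothesis
says that the projection `P₀` onto `Ω` is approximated by `O * R * L` with an error
`C₁ * exp (-C₂ * l)`, where `R` belongs to the algebra of `I`, `L` commutes with it, and `O` acts on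
the sites at distance at most `l` from the two ends of `I`.

*Some eigenvalue of `ρ_I` is bounded below, uniformly in `I`* (`Factorizes.exists_eig_ge`).
The expectation of `O` in the given state is close to one. In the decoupled state, which is the
product of the restrictions to the algebra of `I` and to its commutant, `R * L` still has
expectation close to one, while the expectation of `P₀` is `tr (ρ_I ^ 3)`. If all eigenvalues of
`ρ_I` are small, then so is the expectation of `O` in the decoupled state
(`re_decoupled_le_of_norm_sub_le`). A test which distinguishes the given state from the decoupled
one that well forces the mutual information of the two parts of its support, inside and outside of
`I`, to be at least a multiple of `l` (`entropy_union_le_of_test`). The spectrum of the density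
matrix stays small when `I` is shortened by boundedly many sites, hence this decrement of the
entropy occurs at all dyadic scales at once, and the entropy of a pair of blocks of `2 ^ k * l₀`
sites at the ends of `I` is at most `2 ^ k * (A - c * k)`. This is negative for large `k`, a
contradiction.

*Exponentially decaying Schmidt spectrum* (`Factorizes.exists_concentrated`). Let `u` be an
eigenvector of `ρ_I` with an eigenvalue bounded below, and let `Ψ` be the image of `Ω` under the
projection `|u⟩⟨u|` of the algebra of `I`. Then `O * R * L` maps `Ψ` close to a multiple of `Ω`
which is bounded below, and its image has Schmidt rank at most `d ^ (4 * l)`, because only the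
sites in the support of `O` contribute. So up to an exponentially small error the spectral
distribution of `ρ_I` is carried by `2 * d ^ (4 * l)` eigenvalues, for every `l` below an eighth of
the length of `I`, and such a distribution has bounded entropy
(`sum_negMulLog_le_of_concentrated`).

The relative entropy estimate is reduced to classical probability by the distributions of Nussbaum
and Szkoła, so that no operator inequalities for the logarithm are needed.
-/

noncomputable section

/-! ### One-site operators -/

namespace SpinChain

variable {d : ℕ} [NeZero d]

theorem siteUnitOp_apply (j : ℤ) (a b : Fin d) (f : ConfigSpace d) (σ : Config d) :
    siteUnitOp j a b f σ = if σ j = a then f (σ.update j b) else 0 := rfl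

theorem siteUnitOp_mul (j : ℤ) (a b a' b' : Fin d) :
    siteUnitOp j a b * siteUnitOp j a' b' = if b = a' then siteUnitOp j a b' else 0 := by
  ext f σ
  rw [mul_apply_eq_comp, siteUnitOp_apply, siteUnitOp_apply]
  have hup : (σ.update j b).update j b' = σ.update j b' := by
    ext k; by_cases hk : k = j <;> simp [hk, Function.update_of_ne]
  by_cases h : b = a' <;> by_cases h' : σ j = a <;>
    simp [h, h', siteUnitOp_apply]

theorem siteUnitOp_comm {j k : ℤ} (hjk : j ≠ k) (a b a' b' : Fin d) :
    siteUnitOp j a b * siteUnitOp k a' b' = siteUnitOp k a' b' * siteUnitOp j a b := by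
  ext f σ
  simp only [mul_apply_eq_comp, siteUnitOp_apply]
  have hup : (σ.update j b).update k b' = (σ.update k b').update j b := by
    ext l
    by_cases h1 : l = j <;> by_cases h2 : l = k <;> simp_all
  by_cases h : σ j = a <;> by_cases h' : σ k = a' <;>
    simp [h, h', hup, Function.update_of_ne hjk, Function.update_of_ne hjk.symm]

theorem sum_siteUnitOp (j : ℤ) : ∑ a : Fin d, siteUnitOp j a a = 1 := by
  ext f σ
  have h : ∀ a : Fin d, σ.update j (σ j) = σ := fun a => by
    ext k; by_cases hk : k = j <;> simp [hk]
  rw [sum_apply, lp.coeFn_sum, Finset.sum_apply]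
  simp_rw [siteUnitOp_apply]
  rw [Finset.sum_eq_single (σ j)]
  · simp
  · intro b _ hb; simp [hb.symm]
  · simp

/-- The permutation of configurations which exchanges the levels `a` and `b` at site `j`. -/
def swapAt (j : ℤ) (a b : Fin d) : Equiv.Perm (Config d) :=
  Function.Involutive.toPerm (fun σ => σ.update j (Equiv.swap a b (σ j))) fun σ => by
    ext k; by_cases hk : k = j <;> simp [hk]

theorem swapAt_apply (j : ℤ) (a b : Fin d) (σ : Config d) :
    swapAt j a b σ = σ.update j (Equiv.swap a b (σ j)) := rfl

/-- Matrix units are adjoint to each other: exchanging the two levels at site `j` transforms the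
defining sum of one inner product into that of the other. -/
theorem star_siteUnitOp (j : ℤ) (a b : Fin d) :
    star (siteUnitOp j a b) = siteUnitOp j b a := by
  rw [ContinuousLinearMap.star_eq_adjoint]
  symm
  rw [ContinuousLinearMap.eq_adjoint_iff]
  intro f g
  rw [lp.inner_eq_tsum, lp.inner_eq_tsum, ← Equiv.tsum_eq (swapAt j a b)]
  refine tsum_congr fun σ => ?_
  rw [siteUnitOp_apply, siteUnitOp_apply, swapAt_apply]
  have hup : ∀ x y, (σ.update j x).update j y = σ.update j y := fun x y => by
    ext k; by_cases hk : k = j <;> simp [hk, Function.update_of_ne]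
  by_cases h : σ j = a
  · have h2 : σ.update j a = σ := by
      ext k; by_cases hk : k = j <;> simp [hk, Function.update_of_ne, h]
    simp [h, hup, h2]
  · have : Equiv.swap a b (σ j) ≠ b := fun h' => h (by
      have := (Equiv.swap_apply_eq_iff).1 h'; simpa using this)
    simp [h, this]

/-- The embedding of the one-site matrix algebra at site `j` into the observables. -/
def siteHom (j : ℤ) : Matrix (Fin d) (Fin d) ℂ →⋆ₐ[ℂ] Obs d :=
  StarAlgHom.codRestrict
    { toFun := siteOp j
      map_one' := by
        simp_rw [siteOp, Matrix.one_apply, ite_smul, one_smul, zero_smul]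
        simpa using sum_siteUnitOp (d := d) j
      map_mul' := fun P Q => by
        simp_rw [siteOp, Finset.sum_mul, Finset.mul_sum, smul_mul_smul_comm, siteUnitOp_mul,
          Matrix.mul_apply, Finset.sum_smul]
        refine Finset.sum_congr rfl fun a _ => ?_
        rw [Finset.sum_comm]
        refine Finset.sum_congr rfl fun b _ => ?_
        simp_rw [smul_ite, smul_zero]
        rw [Finset.sum_comm]
        simp
      map_zero' := by simp [siteOp]
      map_add' := fun P Q => by simp [siteOp, add_smul, Finset.sum_add_distrib]
      commutes' := fun r => by
        simp_rw [siteOp, Matrix.algebraMap_matrix_apply, ite_smul, zero_smul]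
        simp only [Finset.sum_ite_eq, Finset.mem_univ, if_true, ← Finset.smul_sum,
          sum_siteUnitOp]
        simp [Algebra.algebraMap_eq_smul_one]
      map_star' := fun P => by
        simp_rw [siteOp, star_sum, star_smul, star_siteUnitOp]
        rw [Finset.sum_comm]
        rfl }
    (quasiLocal d) fun Q => subset_closure (StarAlgebra.subset_adjoin ℂ _ ⟨j, Q, rfl⟩)

theorem siteHom_apply (j : ℤ) (Q : Matrix (Fin d) (Fin d) ℂ) : siteHom j Q = site j Q := rfl

theorem siteOp_comm {j k : ℤ} (hjk : j ≠ k) (P Q : Matrix (Fin d) (Fin d) ℂ) :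
    siteOp j P * siteOp k Q = siteOp k Q * siteOp j P := by
  have h : ∀ a b, Commute (siteUnitOp j a b) (siteOp k Q) := fun a b => by
    refine Commute.sum_right _ _ _ fun a' _ => Commute.sum_right _ _ _ fun b' _ => ?_
    exact Commute.smul_right (siteUnitOp_comm hjk a b a' b') _
  exact Commute.sum_left _ _ _ fun a _ => Commute.sum_left _ _ _ fun b _ =>
    Commute.smul_left (h a b) _

theorem site_commute {j k : ℤ} (hjk : j ≠ k) (P Q : Matrix (Fin d) (Fin d) ℂ) :
    Commute (site j P) (site k Q) :=
  Subtype.ext (siteOp_comm hjk P Q)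

end SpinChain

/-! ### Matrix units and local algebras -/

namespace SpinChain

variable {d : ℕ} [NeZero d]

/-- The product over `j ∈ Λ` of the one-site matrix units `|σ j⟩⟨τ j|`, for global
configurations `σ` and `τ`. Only the values on `Λ` matter; indexing by global configurations
makes products over different regions easy to compare. -/
def unitOn (Λ : Finset ℤ) (σ τ : ℤ → Fin d) : Obs d :=
  Λ.noncommProd (fun j => site j (Matrix.single (σ j) (τ j) 1)) fun _ _ _ _ hjk =>
    site_commute hjk _ _

theorem unitOn_empty (σ τ : ℤ → Fin d) : unitOn ∅ σ τ = 1 := Finset.noncommProd_empty _ _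

theorem unitOn_singleton (j : ℤ) (σ τ : ℤ → Fin d) :
    unitOn {j} σ τ = site j (Matrix.single (σ j) (τ j) 1) :=
  Finset.noncommProd_singleton _ _

theorem unitOn_insert {Λ : Finset ℤ} {j : ℤ} (hj : j ∉ Λ) (σ τ : ℤ → Fin d) :
    unitOn (insert j Λ) σ τ = site j (Matrix.single (σ j) (τ j) 1) * unitOn Λ σ τ :=
  Finset.noncommProd_insert_of_notMem _ _ _ _ hj

theorem unitOn_union {Λ₁ Λ₂ : Finset ℤ} (h : Disjoint Λ₁ Λ₂) (σ τ : ℤ → Fin d) :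
    unitOn (Λ₁ ∪ Λ₂) σ τ = unitOn Λ₁ σ τ * unitOn Λ₂ σ τ :=
  Finset.noncommProd_union_of_disjoint h _ _

theorem site_commute_unitOn {Λ : Finset ℤ} {j : ℤ} (hj : j ∉ Λ) (Q : Matrix (Fin d) (Fin d) ℂ)
    (σ τ : ℤ → Fin d) : Commute (site j Q) (unitOn Λ σ τ) :=
  Finset.noncommProd_commute _ _ _ _ fun _ hk => site_commute (fun h : j = _ => hj (by rwa [h])) _ _

theorem unitOn_mul (Λ : Finset ℤ) (σ τ σ' τ' : ℤ → Fin d) :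
    unitOn Λ σ τ * unitOn Λ σ' τ' = if ∀ j ∈ Λ, τ j = σ' j then unitOn Λ σ τ' else 0 := by
  induction Λ using Finset.induction_on with
  | empty => simp [unitOn_empty]
  | insert j Λ hj ih =>
    have hsite : site j (Matrix.single (σ j) (τ j) 1) * site j (Matrix.single (σ' j) (τ' j) 1) =
        if τ j = σ' j then site j (Matrix.single (σ j) (τ' j) 1) else (0 : Obs d) := by
      simp only [← siteHom_apply, ← map_mul]
      split_ifs with h
      · rw [h, Matrix.single_mul_single_same, mul_one]
      · rw [Matrix.single_mul_single_of_ne (h := h), map_zero]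
    rw [unitOn_insert hj, unitOn_insert hj, unitOn_insert hj, mul_assoc,
      ← mul_assoc (unitOn Λ σ τ), ← (site_commute_unitOn hj _ σ τ).eq, mul_assoc, ih, ← mul_assoc,
      hsite]
    by_cases h : τ j = σ' j <;> by_cases h' : ∀ k ∈ Λ, τ k = σ' k <;> simp [h, h']

theorem star_unitOn (Λ : Finset ℤ) (σ τ : ℤ → Fin d) :
    star (unitOn Λ σ τ) = unitOn Λ τ σ := by
  induction Λ using Finset.induction_on with
  | empty => simp [unitOn_empty]
  | insert j Λ hj ih =>
    rw [unitOn_insert hj, unitOn_insert hj, star_mul, ih, ← siteHom_apply, ← map_star,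
      Matrix.star_eq_conjTranspose, Matrix.conjTranspose_single, star_one, siteHom_apply,
      ← (site_commute_unitOn hj _ τ σ).eq]

/-- The extension by `0` of a configuration on `Λ` to a global configuration. -/
def extendConfig {Λ : Finset ℤ} (s : Λ → Fin d) (j : ℤ) : Fin d :=
  if h : j ∈ Λ then s ⟨j, h⟩ else 0

theorem extendConfig_of_mem {Λ : Finset ℤ} (s : Λ → Fin d) {j : ℤ} (h : j ∈ Λ) :
    extendConfig s j = s ⟨j, h⟩ := dif_pos h

theorem matUnit_eq_unitOn (Λ : Finset ℤ) (s t : Λ → Fin d) {σ τ : ℤ → Fin d}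
    (hσ : ∀ j : Λ, σ j = s j) (hτ : ∀ j : Λ, τ j = t j) : matUnit Λ s t = unitOn Λ σ τ := by
  set f : ℤ → Obs d := fun j => site j (Matrix.single (σ j) (τ j) 1) with hf
  have h1 : Λ.1.map f =
      ((((Finset.univ : Finset Λ).sort (· ≤ ·)).map fun j : Λ => f j : List (Obs d)) :
        Multiset (Obs d)) := by
    rw [← Multiset.map_coe, Finset.sort_eq]
    change _ = Multiset.map (f ∘ ((↑) : Λ → ℤ)) _
    rw [← Multiset.map_map]
    congr 1
    exact (Multiset.attach_map_val Λ.1).symm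
  rw [matUnit]
  simp_rw [← hσ, ← hτ]
  have h2 : ∀ (m : Multiset (Obs d)) (hm) (l : List (Obs d)), m = (l : Multiset (Obs d)) →
      l.prod = Multiset.noncommProd m hm := by
    rintro m hm l rfl
    exact (Multiset.noncommProd_coe _ _).symm
  exact h2 _ (Finset.noncommProd_lemma Λ f fun _ _ _ _ hjk => site_commute hjk _ _) _ h1

theorem matUnit_eq (Λ : Finset ℤ) (s t : Λ → Fin d) :
    matUnit Λ s t = unitOn Λ (extendConfig s) (extendConfig t) :=
  matUnit_eq_unitOn Λ s t (fun j => extendConfig_of_mem s j.2) fun j => extendConfig_of_mem t j.2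

theorem unitOn_eq_matUnit (Λ : Finset ℤ) (σ τ : ℤ → Fin d) :
    unitOn Λ σ τ = matUnit Λ (fun j => σ j) fun j => τ j :=
  (matUnit_eq_unitOn Λ _ _ (fun _ => rfl) fun _ => rfl).symm

theorem matUnit_mul (Λ : Finset ℤ) (s t s' t' : Λ → Fin d) :
    matUnit Λ s t * matUnit Λ s' t' = if t = s' then matUnit Λ s t' else 0 := by
  simp only [matUnit_eq, unitOn_mul]
  refine if_congr ⟨fun h => funext fun j => ?_, fun h j hj => by rw [h]⟩ rfl rfl
  simpa [extendConfig_of_mem _ j.2] using h j j.2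

theorem star_matUnit (Λ : Finset ℤ) (s t : Λ → Fin d) :
    star (matUnit Λ s t) = matUnit Λ t s := by
  simp only [matUnit_eq, star_unitOn]

/-- The restriction of a configuration to a smaller region. -/
def restr {Λ₁ Λ : Finset ℤ} (h : Λ₁ ⊆ Λ) (s : Λ → Fin d) : Λ₁ → Fin d :=
  fun j => s ⟨j, h j.2⟩

/-- Configurations on a disjoint union are pairs of configurations. The union is a variable `Λ` with
an equation, so that regions given in another form need no casts. -/
def splitConfig {Λ₁ Λ₂ Λ : Finset ℤ} (hd : Disjoint Λ₁ Λ₂) (hu : Λ₁ ∪ Λ₂ = Λ) :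
    (Λ → Fin d) ≃ (Λ₁ → Fin d) × (Λ₂ → Fin d) where
  toFun s := (restr (hu ▸ Finset.subset_union_left) s, restr (hu ▸ Finset.subset_union_right) s)
  invFun p j := if h : (j : ℤ) ∈ Λ₁ then p.1 ⟨j, h⟩ else
    p.2 ⟨j, (Finset.mem_union.1 (hu.symm ▸ j.2 : (j : ℤ) ∈ Λ₁ ∪ Λ₂)).resolve_left h⟩
  left_inv s := by
    funext j
    by_cases h : (j : ℤ) ∈ Λ₁ <;> simp [h, restr]
  right_inv p := by
    refine Prod.ext (funext fun j => ?_) (funext fun j => ?_)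
    · simp [restr]
    · have : (j : ℤ) ∉ Λ₁ := fun h => Finset.disjoint_left.1 hd h j.2
      simp [restr, this]

theorem matUnit_split {Λ₁ Λ₂ Λ : Finset ℤ} (hd : Disjoint Λ₁ Λ₂) (hu : Λ₁ ∪ Λ₂ = Λ)
    (s t : Λ → Fin d) :
    matUnit Λ s t = matUnit Λ₁ (splitConfig hd hu s).1 (splitConfig hd hu t).1 *
      matUnit Λ₂ (splitConfig hd hu s).2 (splitConfig hd hu t).2 := by
  subst hu
  rw [matUnit_eq, unitOn_union hd, unitOn_eq_matUnit Λ₁, unitOn_eq_matUnit Λ₂]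
  congr 2 <;> funext j <;> simp [splitConfig, restr, extendConfig]

theorem sum_matUnit (Λ : Finset ℤ) : ∑ s : Λ → Fin d, matUnit Λ s s = 1 := by
  induction Λ using Finset.induction_on with
  | empty => simp [matUnit_eq, unitOn_empty]
  | insert j Λ hj ih =>
    have hd : Disjoint {j} Λ := by simpa using hj
    have h1 : ∑ s : ({j} : Finset ℤ) → Fin d, matUnit {j} s s = 1 := by
      simp_rw [matUnit_eq, unitOn_singleton]
      rw [← Equiv.sum_comp (Equiv.funUnique ({j} : Finset ℤ) (Fin d)).symm, ← map_one (siteHom j),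
        ← Matrix.sum_single_one, map_sum]
      refine Finset.sum_congr rfl fun a _ => ?_
      rw [extendConfig_of_mem _ (Finset.mem_singleton_self j)]
      rfl
    simp_rw [matUnit_split hd (Finset.insert_eq j Λ).symm]
    rw [Equiv.sum_comp (splitConfig hd (Finset.insert_eq j Λ).symm)
      (fun p : (({j} : Finset ℤ) → Fin d) × (Λ → Fin d) =>
        matUnit {j} p.1 p.1 * matUnit Λ p.2 p.2), Fintype.sum_prod_type]
    simp_rw [← Finset.mul_sum, ih, mul_one, h1]

/-- The embedding of the full matrix algebra indexed by the configurations on `Λ` into the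
observables. Its range is `𝔄_Λ`, see `mem_localAlg_iff`. -/
def matHom (Λ : Finset ℤ) : Matrix (Λ → Fin d) (Λ → Fin d) ℂ →⋆ₐ[ℂ] Obs d where
  toFun M := ∑ s, ∑ t, M s t • matUnit Λ s t
  map_one' := by
    simp_rw [Matrix.one_apply, ite_smul, one_smul, zero_smul]
    simpa using sum_matUnit (d := d) Λ
  map_mul' P Q := by
    simp_rw [Finset.sum_mul, Finset.mul_sum, smul_mul_smul_comm, matUnit_mul,
      Matrix.mul_apply, Finset.sum_smul]
    refine Finset.sum_congr rfl fun a _ => ?_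
    rw [Finset.sum_comm]
    refine Finset.sum_congr rfl fun b _ => ?_
    simp_rw [smul_ite, smul_zero]
    rw [Finset.sum_comm]
    simp
  map_zero' := by simp
  map_add' P Q := by simp [add_smul, Finset.sum_add_distrib]
  commutes' r := by
    simp_rw [Matrix.algebraMap_matrix_apply, ite_smul, zero_smul]
    simp only [Finset.sum_ite_eq, Finset.mem_univ, if_true, ← Finset.smul_sum, sum_matUnit]
    simp [Algebra.algebraMap_eq_smul_one]
  map_star' P := by
    simp_rw [star_sum, star_smul, star_matUnit]
    rw [Finset.sum_comm]
    rfl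

theorem matHom_apply (Λ : Finset ℤ) (M : Matrix (Λ → Fin d) (Λ → Fin d) ℂ) :
    matHom Λ M = ∑ s, ∑ t, M s t • matUnit Λ s t := rfl

theorem matHom_single (Λ : Finset ℤ) (s t : Λ → Fin d) :
    matHom Λ (Matrix.single s t 1) = matUnit Λ s t := by
  rw [matHom_apply, Finset.sum_eq_single s, Finset.sum_eq_single t]
  · simp
  · intro b _ hb; simp [Matrix.single_apply_of_col_ne _ _ hb.symm]
  · simp
  · intro b _ hb
    refine Finset.sum_eq_zero fun t' _ => ?_
    simp [Matrix.single_apply_of_row_ne hb.symm]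
  · simp

/-- Ampliation: `M ⊗ 1` represents in the larger region the observable that `M` represents in the
smaller one. -/
theorem exists_matHom_eq_of_subset {Λ₁ Λ : Finset ℤ} (h : Λ₁ ⊆ Λ)
    (M : Matrix (Λ₁ → Fin d) (Λ₁ → Fin d) ℂ) : ∃ N, matHom Λ N = matHom Λ₁ M := by
  have hd : Disjoint Λ₁ (Λ \ Λ₁) := Finset.disjoint_sdiff
  have hu : Λ₁ ∪ (Λ \ Λ₁) = Λ := Finset.union_sdiff_of_subset h
  have key : ∀ s t : Λ₁ → Fin d, matUnit Λ₁ s t ∈ (matHom (d := d) Λ).range := fun s t => by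
    rw [← mul_one (matUnit Λ₁ s t), ← sum_matUnit (Λ \ Λ₁), Finset.mul_sum]
    refine sum_mem fun r _ => ⟨Matrix.single ((splitConfig hd hu).symm (s, r))
      ((splitConfig hd hu).symm (t, r)) 1, ?_⟩
    refine (matHom_single _ _ _).trans ?_
    rw [matUnit_split hd hu]
    simp
  have : matHom Λ₁ M ∈ (matHom (d := d) Λ).range := by
    rw [matHom_apply]
    exact sum_mem fun s _ => sum_mem fun t _ => SMulMemClass.smul_mem _ (key s t)
  exact this

/-- The `⋆`-subalgebra generated by finitely many sites is finite-dimensional, hence closed already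
before the completion: it consists of the linear combinations of matrix units. -/
theorem mem_localAlg_iff (Λ : Finset ℤ) (x : Obs d) :
    x ∈ localAlg d (Λ : Set ℤ) ↔ ∃ M, matHom Λ M = x := by
  constructor
  · intro hx
    have hcl : IsClosed ((matHom (d := d) Λ).range : Set (Obs d)) :=
      Submodule.closed_of_finiteDimensional (matHom (d := d) Λ).toAlgHom.toLinearMap.range
    refine StarSubalgebra.topologicalClosure_minimal (t := (matHom (d := d) Λ).range) ?_ hcl hx
    rw [StarAlgebra.adjoin_le_iff]
    rintro _ ⟨j, hj, Q, rfl⟩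
    have hsmul : ∀ a b c, siteHom j (Matrix.single a b c) =
        c • (site j (Matrix.single a b 1) : Obs d) := fun a b c => by
      rw [← siteHom_apply, ← map_smul, Matrix.smul_single, smul_eq_mul, mul_one]
    have hQ : site j Q =
        matHom ({j} : Finset ℤ) (Q.submatrix (fun s => s ⟨j, Finset.mem_singleton_self j⟩)
          (fun s => s ⟨j, Finset.mem_singleton_self j⟩)) := by
      rw [← siteHom_apply, matHom_apply]
      conv_lhs => rw [Matrix.matrix_eq_sum_single Q]
      simp_rw [map_sum]
      rw [← Equiv.sum_comp (Equiv.funUnique ({j} : Finset ℤ) (Fin d))]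
      refine Finset.sum_congr rfl fun s _ => ?_
      rw [← Equiv.sum_comp (Equiv.funUnique ({j} : Finset ℤ) (Fin d))]
      refine Finset.sum_congr rfl fun t _ => ?_
      rw [hsmul, matUnit_eq, unitOn_singleton, extendConfig_of_mem _ (Finset.mem_singleton_self j),
        extendConfig_of_mem _ (Finset.mem_singleton_self j)]
      rfl
    obtain ⟨N, hN⟩ := exists_matHom_eq_of_subset (Λ := Λ)
      (Finset.singleton_subset_iff.2 hj) (Q.submatrix
        (fun s : ({j} : Finset ℤ) → Fin d => s ⟨j, Finset.mem_singleton_self j⟩)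
          (fun s => s ⟨j, Finset.mem_singleton_self j⟩))
    exact ⟨N, hN.trans hQ.symm⟩
  · rintro ⟨M, rfl⟩
    rw [matHom_apply]
    refine sum_mem fun s _ => sum_mem fun t _ => SMulMemClass.smul_mem _ ?_
    rw [matUnit]
    refine list_prod_mem ?_
    simp only [List.mem_map]
    rintro _ ⟨j, _, rfl⟩
    exact subset_closure (StarAlgebra.subset_adjoin ℂ _ ⟨j, j.2, _, rfl⟩)

theorem localAlg_mono {Λ₁ Λ₂ : Set ℤ} (h : Λ₁ ⊆ Λ₂) : localAlg d Λ₁ ≤ localAlg d Λ₂ :=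
  StarSubalgebra.topologicalClosure_mono (StarAlgebra.adjoin_mono
    fun _ ⟨j, hj, Q, hx⟩ => ⟨j, h hj, Q, hx⟩)

/-- Locality: observables of disjoint regions commute. -/
theorem commute_of_mem_localAlg {Λ₁ : Finset ℤ} {Λ₂ : Set ℤ} (h : Disjoint (Λ₁ : Set ℤ) Λ₂)
    {x y : Obs d} (hx : x ∈ localAlg d (Λ₁ : Set ℤ)) (hy : y ∈ localAlg d Λ₂) : Commute x y := by
  have h1 : ∀ j ∈ Λ₂, ∀ Q : Matrix (Fin d) (Fin d) ℂ,
      ∀ z ∈ localAlg d (Λ₁ : Set ℤ), z * site j Q = site j Q * z := by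
    intro j hj Q z hz
    obtain ⟨M, rfl⟩ := (mem_localAlg_iff _ _).1 hz
    rw [matHom_apply]
    refine Commute.sum_left _ _ _ fun s _ => Commute.sum_left _ _ _ fun t _ =>
      Commute.smul_left ?_ _
    rw [matUnit_eq]
    exact (site_commute_unitOn (fun hj' => Set.disjoint_left.1 h hj' hj) _ _ _).symm
  have hle : localAlg d Λ₂ ≤
      StarSubalgebra.centralizer ℂ (localAlg d (Λ₁ : Set ℤ) : Set (Obs d)) := by
    refine StarSubalgebra.topologicalClosure_minimal ?_ ?_
    · rw [StarAlgebra.adjoin_le_iff]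
      rintro _ ⟨j, hj, Q, rfl⟩
      rw [SetLike.mem_coe, StarSubalgebra.mem_centralizer_iff]
      exact fun z hz => ⟨h1 j hj Q z hz, h1 j hj Q _ (star_mem hz)⟩
    · rw [StarSubalgebra.coe_centralizer]
      exact Set.isClosed_centralizer _
  exact ((StarSubalgebra.mem_centralizer_iff _).1 (hle hy) x hx).1

end SpinChain

/-! ### A lower bound for the relative entropy -/

namespace SpinChain

/-- For `K = 1` this is Gibbs' inequality `-r log r ≤ -r log s + s - r`, up to the term `-r`. For
`K > 1` a gain of `r log K` is possible as soon as `r` exceeds `K s`. -/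
theorem negMulLog_le_of_nonneg {r s K : ℝ} (hr : 0 ≤ r) (hs : 0 < s) (hK : 1 ≤ K) :
    Real.negMulLog r ≤ -(r * Real.log s) - Real.log K * r + Real.log K * min r (K * s) + s := by
  have hL : 0 ≤ Real.log K := Real.log_nonneg hK
  have hK0 : 0 < K := by linarith
  rcases le_total (K * s) r with h | h
  · have hr0 : 0 < r := lt_of_lt_of_le (by positivity) h
    have h1 : Real.log K + Real.log s ≤ Real.log r := by
      rw [← Real.log_mul hK0.ne' hs.ne']
      exact Real.log_le_log (by positivity) h
    have h2 := mul_le_mul_of_nonneg_left h1 hr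
    have h3 : 0 ≤ Real.log K * min r (K * s) := mul_nonneg hL (le_min hr (by positivity))
    rw [Real.negMulLog]
    nlinarith
  · rw [min_eq_left h, Real.negMulLog]
    rcases hr.eq_or_lt with rfl | hr0
    · simpa using hs.le
    · have h1 := Real.log_le_sub_one_of_pos (div_pos hs hr0)
      rw [Real.log_div hs.ne' hr0.ne'] at h1
      have h2 := mul_le_mul_of_nonneg_left h1 hr
      have h3 : r * (s / r - 1) = s - r := by field_simp
      nlinarith

/-- A lower bound for the relative entropy of two density matrices, given by spectral data
`(r, u)` and `(s, v)`, in terms of a test `T` that is likely under the first and unlikely under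
the second. The numbers `r i * |⟪v k, u i⟫|²` and `s k * |⟪v k, u i⟫|²` are two classical
distributions with the same relative entropy (Nussbaum and Szkoła), so that the scalar bound
`negMulLog_le_of_nonneg` can be summed. -/
theorem sum_negMulLog_le_of_test {ι κ E : Type*} [Fintype ι] [Fintype κ] [NormedAddCommGroup E]
    [InnerProductSpace ℂ E] (u : OrthonormalBasis ι ℂ E) (v : OrthonormalBasis κ ℂ E)
    {r : ι → ℝ} {s : κ → ℝ} (hr : ∀ i, 0 ≤ r i) (hs : ∀ k, 0 ≤ s k) (hr1 : ∑ i, r i = 1)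
    (hs1 : ∑ k, s k = 1) (habs : ∀ i k, s k = 0 → r i * ‖⟪v k, u i⟫_ℂ‖ ^ 2 = 0)
    {T : E →ₗ[ℂ] E} (hT : T.IsSymmetric) (hT2 : ∀ x, ‖T x‖ ^ 2 ≤ (⟪x, T x⟫_ℂ).re)
    {δ q K : ℝ} (hK : 1 ≤ K) (hδ : 1 - δ ≤ ∑ i, r i * (⟪u i, T (u i)⟫_ℂ).re)
    (hq : ∑ k, s k * (⟪v k, T (v k)⟫_ℂ).re ≤ q) :
    ∑ i, Real.negMulLog (r i) ≤ -(∑ k, (∑ i, r i * ‖⟪v k, u i⟫_ℂ‖ ^ 2) * Real.log (s k))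
      - Real.log K * (1 - 2 * (δ + K * q)) + 1 := by
  have hL : 0 ≤ Real.log K := Real.log_nonneg hK
  have hK0 : 0 ≤ K := by linarith
  set w : ι → κ → ℝ := fun i k => ‖⟪v k, u i⟫_ℂ‖ ^ 2 with hw
  have hw0 : ∀ i k, 0 ≤ w i k := fun i k => by positivity
  have hwk : ∀ i, ∑ k, w i k = 1 := fun i => by
    rw [hw, v.sum_sq_norm_inner_right, u.orthonormal.1 i, one_pow]
  have hwi : ∀ k, ∑ i, w i k = 1 := fun k => by
    rw [hw, u.sum_sq_norm_inner_left, v.orthonormal.1 k, one_pow]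
  have hsub : ∀ x, ‖x - T x‖ ^ 2 ≤ ‖x‖ ^ 2 - (⟪x, T x⟫_ℂ).re := fun x => by
    have := hT2 x
    rw [@norm_sub_sq ℂ, RCLike.re_to_complex]
    linarith
  have hmin : ∑ i, ∑ k, w i k * min (r i) (K * s k) ≤ 2 * (δ + K * q) := by
    -- split `⟪v k, u i⟫` by `1 = (1 - T) + T`, and use `r i` for the first and `K * s k` for the
    -- second part
    have h1 : ∀ i k, w i k * min (r i) (K * s k) ≤
        2 * (r i * ‖⟪v k, u i - T (u i)⟫_ℂ‖ ^ 2) + 2 * (K * (s k * ‖⟪T (v k), u i⟫_ℂ‖ ^ 2)) := by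
      intro i k
      have hsplit : ⟪v k, u i⟫_ℂ = ⟪v k, u i - T (u i)⟫_ℂ + ⟪T (v k), u i⟫_ℂ := by
        rw [hT, ← inner_add_right, sub_add_cancel]
      have h2 : w i k ≤ 2 * ‖⟪v k, u i - T (u i)⟫_ℂ‖ ^ 2 + 2 * ‖⟪T (v k), u i⟫_ℂ‖ ^ 2 := by
        have h3 := norm_add_le (⟪v k, u i - T (u i)⟫_ℂ) (⟪T (v k), u i⟫_ℂ)
        rw [← hsplit] at h3
        have h4 := pow_le_pow_left₀ (norm_nonneg _) h3 2
        have h5 := add_pow_le (norm_nonneg (⟪v k, u i - T (u i)⟫_ℂ))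
          (norm_nonneg (⟪T (v k), u i⟫_ℂ)) 2
        calc w i k ≤ _ := h4
          _ ≤ _ := h5
          _ = _ := by ring
      have hmn : 0 ≤ min (r i) (K * s k) := le_min (hr i) (mul_nonneg hK0 (hs k))
      have h6 := mul_le_mul_of_nonneg_right h2 hmn
      have h7 := mul_le_mul_of_nonneg_left (min_le_left (r i) (K * s k))
        (by positivity : 0 ≤ ‖⟪v k, u i - T (u i)⟫_ℂ‖ ^ 2)
      have h8 := mul_le_mul_of_nonneg_left (min_le_right (r i) (K * s k))
        (by positivity : 0 ≤ ‖⟪T (v k), u i⟫_ℂ‖ ^ 2)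
      nlinarith
    have h9 : ∑ i, ∑ k, r i * ‖⟪v k, u i - T (u i)⟫_ℂ‖ ^ 2 ≤ δ := by
      simp_rw [← Finset.mul_sum, v.sum_sq_norm_inner_right]
      calc ∑ i, r i * ‖u i - T (u i)‖ ^ 2
          ≤ ∑ i, r i * (1 - (⟪u i, T (u i)⟫_ℂ).re) := by
            refine Finset.sum_le_sum fun i _ => mul_le_mul_of_nonneg_left ?_ (hr i)
            simpa [u.orthonormal.1 i] using hsub (u i)
        _ ≤ δ := by
            simp_rw [mul_sub, mul_one, Finset.sum_sub_distrib, hr1]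
            linarith
    have h10 : ∑ i, ∑ k, s k * ‖⟪T (v k), u i⟫_ℂ‖ ^ 2 ≤ q := by
      rw [Finset.sum_comm]
      simp_rw [← Finset.mul_sum, u.sum_sq_norm_inner_left]
      exact (Finset.sum_le_sum fun k _ => mul_le_mul_of_nonneg_left (hT2 (v k)) (hs k)).trans hq
    calc _ ≤ ∑ i, ∑ k, (2 * (r i * ‖⟪v k, u i - T (u i)⟫_ℂ‖ ^ 2) +
          2 * (K * (s k * ‖⟪T (v k), u i⟫_ℂ‖ ^ 2))) :=
          Finset.sum_le_sum fun i _ => Finset.sum_le_sum fun k _ => h1 i k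
      _ = 2 * (∑ i, ∑ k, r i * ‖⟪v k, u i - T (u i)⟫_ℂ‖ ^ 2) +
          2 * (K * ∑ i, ∑ k, s k * ‖⟪T (v k), u i⟫_ℂ‖ ^ 2) := by
          simp_rw [Finset.sum_add_distrib, Finset.mul_sum]
      _ ≤ _ := by nlinarith [mul_le_mul_of_nonneg_left h10 hK0]
  have hpt : ∀ i k, w i k * Real.negMulLog (r i) ≤ -(r i * w i k * Real.log (s k))
      - Real.log K * (r i * w i k) + Real.log K * (w i k * min (r i) (K * s k)) +
      s k * w i k := by
    intro i k
    rcases (hs k).eq_or_lt with h0 | h0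
    · have := habs i k h0.symm
      rcases mul_eq_zero.1 this with h | h
      · simp [h, ← h0]
      · have : w i k = 0 := h
        simp [this]
    · have := mul_le_mul_of_nonneg_left (negMulLog_le_of_nonneg (hr i) h0 hK) (hw0 i k)
      linarith
  have hsum := Finset.sum_le_sum fun i (_ : i ∈ Finset.univ) =>
    Finset.sum_le_sum fun k (_ : k ∈ Finset.univ) => hpt i k
  have e1 : ∑ i, ∑ k, w i k * Real.negMulLog (r i) = ∑ i, Real.negMulLog (r i) := by
    simp_rw [← Finset.sum_mul, hwk, one_mul]
  have e2 : ∑ i, ∑ k, r i * w i k = 1 := by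
    simp_rw [← Finset.mul_sum, hwk, mul_one, hr1]
  have e3 : ∑ i, ∑ k, s k * w i k = 1 := by
    rw [Finset.sum_comm]
    simp_rw [← Finset.mul_sum, hwi, mul_one, hs1]
  have e4 : ∑ i, ∑ k, r i * w i k * Real.log (s k) =
      ∑ k, (∑ i, r i * w i k) * Real.log (s k) := by
    rw [Finset.sum_comm]
    simp_rw [Finset.sum_mul]
  simp only [Finset.sum_add_distrib, Finset.sum_sub_distrib, Finset.sum_neg_distrib,
    ← Finset.mul_sum] at hsum e2
  rw [e1, e2, e3] at hsum
  rw [e4] at hsum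
  have := mul_le_mul_of_nonneg_left hmin hL
  linarith

end SpinChain

/-! ### Rank one matrices and the spectrum of the density matrix -/

namespace SpinChain

section KetBra

variable {X : Type*}

/-- The matrix of the rank one operator `|x⟩⟨y|`. -/
def ketBra (x y : EuclideanSpace ℂ X) : Matrix X X ℂ := Matrix.of fun s t => x s * star (y t)

theorem ketBra_apply (x y : EuclideanSpace ℂ X) (s t : X) : ketBra x y s t = x s * star (y t) :=
  rfl

theorem star_ketBra (x y : EuclideanSpace ℂ X) : star (ketBra x y) = ketBra y x := by
  ext s t
  simp [Matrix.star_apply, ketBra_apply, mul_comm]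

theorem euclidean_inner_eq_sum [Fintype X] (x y : EuclideanSpace ℂ X) :
    ⟪x, y⟫_ℂ = ∑ s, star (x s) * y s := by
  simp [PiLp.inner_apply, mul_comm]

variable [Fintype X]

theorem ketBra_mul_ketBra (x y z w : EuclideanSpace ℂ X) :
    ketBra x y * ketBra z w = ⟪y, z⟫_ℂ • ketBra x w := by
  ext s t
  simp only [Matrix.mul_apply, ketBra_apply, Matrix.smul_apply, euclidean_inner_eq_sum,
    smul_eq_mul, Finset.sum_mul]
  exact Finset.sum_congr rfl fun i _ => by ring

variable [DecidableEq X]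

theorem mul_ketBra (M : Matrix X X ℂ) (x y : EuclideanSpace ℂ X) :
    M * ketBra x y = ketBra (M.toEuclideanLin x) y := by
  ext s t
  simp [Matrix.mul_apply, ketBra_apply, Matrix.mulVec, dotProduct, Finset.sum_mul, mul_assoc]

theorem ketBra_mul_mul_ketBra (M : Matrix X X ℂ) (x y z w : EuclideanSpace ℂ X) :
    ketBra x y * M * ketBra z w = ⟪y, M.toEuclideanLin z⟫_ℂ • ketBra x w := by
  rw [mul_assoc, mul_ketBra, ketBra_mul_ketBra]

theorem sum_ketBra {ι : Type*} [Fintype ι] (u : OrthonormalBasis ι ℂ (EuclideanSpace ℂ X)) :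
    ∑ i, ketBra (u i) (u i) = 1 := by
  ext s t
  have h := u.sum_inner_mul_inner (EuclideanSpace.single s (1 : ℂ)) (EuclideanSpace.single t 1)
  rw [EuclideanSpace.inner_single_left] at h
  simp only [EuclideanSpace.inner_single_left, EuclideanSpace.inner_single_right, map_one,
    one_mul] at h
  rw [Matrix.sum_apply]
  simp only [ketBra_apply]
  refine Eq.trans ?_ (h.trans ?_)
  · rfl
  · simp [Matrix.one_apply]

end KetBra

variable {d : ℕ}

/-- The product vector `x ⊗ y` on a disjoint union. -/
def tensorVec {Λ₁ Λ₂ Λ : Finset ℤ} (hd : Disjoint Λ₁ Λ₂) (hu : Λ₁ ∪ Λ₂ = Λ)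
    (x : EuclideanSpace ℂ (Λ₁ → Fin d)) (y : EuclideanSpace ℂ (Λ₂ → Fin d)) :
    EuclideanSpace ℂ (Λ → Fin d) :=
  WithLp.toLp 2 fun s => x (splitConfig hd hu s).1 * y (splitConfig hd hu s).2

theorem tensorVec_apply {Λ₁ Λ₂ Λ : Finset ℤ} (hd : Disjoint Λ₁ Λ₂) (hu : Λ₁ ∪ Λ₂ = Λ)
    (x : EuclideanSpace ℂ (Λ₁ → Fin d)) (y : EuclideanSpace ℂ (Λ₂ → Fin d)) (s : Λ → Fin d) :
    tensorVec hd hu x y s = x (splitConfig hd hu s).1 * y (splitConfig hd hu s).2 := rfl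

theorem inner_tensorVec {Λ₁ Λ₂ Λ : Finset ℤ} (hd : Disjoint Λ₁ Λ₂) (hu : Λ₁ ∪ Λ₂ = Λ)
    (x x' : EuclideanSpace ℂ (Λ₁ → Fin d)) (y y' : EuclideanSpace ℂ (Λ₂ → Fin d)) :
    ⟪tensorVec hd hu x y, tensorVec hd hu x' y'⟫_ℂ = ⟪x, x'⟫_ℂ * ⟪y, y'⟫_ℂ := by
  simp_rw [euclidean_inner_eq_sum, tensorVec_apply]
  rw [Equiv.sum_comp (splitConfig hd hu) (fun p : (Λ₁ → Fin d) × (Λ₂ → Fin d) =>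
    star (x p.1 * y p.2) * (x' p.1 * y' p.2)), Fintype.sum_prod_type, Finset.sum_mul]
  refine Finset.sum_congr rfl fun s _ => ?_
  rw [Finset.mul_sum]
  refine Finset.sum_congr rfl fun t _ => ?_
  rw [star_mul']; ring

/-- The product of two orthonormal bases. -/
def tensorBasis {Λ₁ Λ₂ Λ : Finset ℤ} (hd : Disjoint Λ₁ Λ₂) (hu : Λ₁ ∪ Λ₂ = Λ)
    (u₁ : OrthonormalBasis (Λ₁ → Fin d) ℂ (EuclideanSpace ℂ (Λ₁ → Fin d)))
    (u₂ : OrthonormalBasis (Λ₂ → Fin d) ℂ (EuclideanSpace ℂ (Λ₂ → Fin d))) :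
    OrthonormalBasis ((Λ₁ → Fin d) × (Λ₂ → Fin d)) ℂ (EuclideanSpace ℂ (Λ → Fin d)) :=
  have ho : Orthonormal ℂ fun k : (Λ₁ → Fin d) × (Λ₂ → Fin d) =>
      tensorVec hd hu (u₁ k.1) (u₂ k.2) := by
    rw [orthonormal_iff_ite]
    rintro ⟨i, j⟩ ⟨i', j'⟩
    rw [inner_tensorVec, orthonormal_iff_ite.1 u₁.orthonormal, orthonormal_iff_ite.1 u₂.orthonormal]
    by_cases h : i = i' <;> by_cases h' : j = j' <;> simp [h, h']
  have hcard : Fintype.card ((Λ₁ → Fin d) × (Λ₂ → Fin d)) =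
      Module.finrank ℂ (EuclideanSpace ℂ (Λ → Fin d)) := by
    rw [finrank_euclideanSpace]
    exact (Fintype.card_congr (splitConfig hd hu)).symm
  OrthonormalBasis.mk ho (by
    rw [ho.linearIndependent.span_eq_top_of_card_eq_finrank' hcard])

theorem tensorBasis_apply {Λ₁ Λ₂ Λ : Finset ℤ} (hd : Disjoint Λ₁ Λ₂) (hu : Λ₁ ∪ Λ₂ = Λ)
    (u₁ : OrthonormalBasis (Λ₁ → Fin d) ℂ (EuclideanSpace ℂ (Λ₁ → Fin d)))
    (u₂ : OrthonormalBasis (Λ₂ → Fin d) ℂ (EuclideanSpace ℂ (Λ₂ → Fin d)))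
    (k : (Λ₁ → Fin d) × (Λ₂ → Fin d)) :
    tensorBasis hd hu u₁ u₂ k = tensorVec hd hu (u₁ k.1) (u₂ k.2) := by
  simp [tensorBasis]

variable [NeZero d]

theorem matHom_eq_mul_of_entries {Λ₁ Λ₂ Λ : Finset ℤ} (hd : Disjoint Λ₁ Λ₂) (hu : Λ₁ ∪ Λ₂ = Λ)
    (N : Matrix (Λ → Fin d) (Λ → Fin d) ℂ) (M₁ : Matrix (Λ₁ → Fin d) (Λ₁ → Fin d) ℂ)
    (M₂ : Matrix (Λ₂ → Fin d) (Λ₂ → Fin d) ℂ)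
    (h : ∀ s t, N s t = M₁ (splitConfig hd hu s).1 (splitConfig hd hu t).1 *
      M₂ (splitConfig hd hu s).2 (splitConfig hd hu t).2) :
    matHom Λ N = matHom Λ₁ M₁ * matHom Λ₂ M₂ := by
  simp_rw [matHom_apply, h, matUnit_split hd hu]
  rw [Equiv.sum_comp (splitConfig hd hu) (fun p : (Λ₁ → Fin d) × (Λ₂ → Fin d) => ∑ t : Λ → Fin d,
    (M₁ p.1 (splitConfig hd hu t).1 * M₂ p.2 (splitConfig hd hu t).2) •
      (matUnit Λ₁ p.1 (splitConfig hd hu t).1 * matUnit Λ₂ p.2 (splitConfig hd hu t).2))]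
  have : ∀ p : (Λ₁ → Fin d) × (Λ₂ → Fin d), ∑ t : Λ → Fin d,
      (M₁ p.1 (splitConfig hd hu t).1 * M₂ p.2 (splitConfig hd hu t).2) •
        (matUnit Λ₁ p.1 (splitConfig hd hu t).1 * matUnit Λ₂ p.2 (splitConfig hd hu t).2) =
      (∑ t₁, M₁ p.1 t₁ • matUnit Λ₁ p.1 t₁) * ∑ t₂, M₂ p.2 t₂ • matUnit Λ₂ p.2 t₂ := fun p => by
    rw [Equiv.sum_comp (splitConfig hd hu) (fun q : (Λ₁ → Fin d) × (Λ₂ → Fin d) =>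
      (M₁ p.1 q.1 * M₂ p.2 q.2) • (matUnit Λ₁ p.1 q.1 * matUnit Λ₂ p.2 q.2)),
      Fintype.sum_prod_type, Finset.sum_mul]
    refine Finset.sum_congr rfl fun t₁ _ => ?_
    rw [Finset.mul_sum]
    exact Finset.sum_congr rfl fun t₂ _ => (smul_mul_smul_comm _ _ _ _).symm
  rw [Finset.sum_congr rfl fun p _ => this p, Fintype.sum_prod_type]
  rw [Finset.sum_mul_sum]

theorem matHom_ketBra_tensorVec {Λ₁ Λ₂ Λ : Finset ℤ} (hd : Disjoint Λ₁ Λ₂) (hu : Λ₁ ∪ Λ₂ = Λ)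
    (x x' : EuclideanSpace ℂ (Λ₁ → Fin d)) (y y' : EuclideanSpace ℂ (Λ₂ → Fin d)) :
    matHom Λ (ketBra (tensorVec hd hu x y) (tensorVec hd hu x' y')) =
      matHom Λ₁ (ketBra x x') * matHom Λ₂ (ketBra y y') := by
  refine matHom_eq_mul_of_entries hd hu _ _ _ fun s t => ?_
  simp only [ketBra_apply, tensorVec_apply, star_mul']
  ring

namespace State

variable (φ : State d)

theorem toPos_matHom (Λ : Finset ℤ) (M : Matrix (Λ → Fin d) (Λ → Fin d) ℂ) :
    φ.toPos (matHom Λ M) = ∑ s, ∑ t, M s t * φ.density Λ t s := by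
  simp_rw [matHom_apply, map_sum, map_smul]
  rfl

theorem toPos_matHom_ketBra (Λ : Finset ℤ) (x y : EuclideanSpace ℂ (Λ → Fin d)) :
    φ.toPos (matHom Λ (ketBra x y)) = ⟪y, (φ.density Λ).toEuclideanLin x⟫_ℂ := by
  rw [toPos_matHom, euclidean_inner_eq_sum, Finset.sum_comm]
  refine Finset.sum_congr rfl fun t _ => ?_
  simp only [ketBra_apply, Matrix.toLpLin_apply, Matrix.mulVec, dotProduct, Finset.mul_sum]
  exact Finset.sum_congr rfl fun s _ => by ring

theorem isHermitian_density (Λ : Finset ℤ) : (φ.density Λ).IsHermitian := by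
  ext s t
  rw [Matrix.conjTranspose_apply]
  change star (φ.toPos (matUnit Λ s t)) = φ.toPos (matUnit Λ t s)
  rw [← map_star, star_matUnit]

/-- The eigenvalues of the density matrix, indexed like its rows and columns; the index carries no
further meaning. -/
def eig (Λ : Finset ℤ) : (Λ → Fin d) → ℝ := (φ.isHermitian_density Λ).eigenvalues

/-- An orthonormal basis of eigenvectors of the density matrix, for the eigenvalues `eig`. -/
def eigBasis (Λ : Finset ℤ) :
    OrthonormalBasis (Λ → Fin d) ℂ (EuclideanSpace ℂ (Λ → Fin d)) :=
  (φ.isHermitian_density Λ).eigenvectorBasis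

theorem density_eigBasis (Λ : Finset ℤ) (i : Λ → Fin d) :
    (φ.density Λ).toEuclideanLin (φ.eigBasis Λ i) = (φ.eig Λ i : ℂ) • φ.eigBasis Λ i := by
  ext s
  have := congrFun ((φ.isHermitian_density Λ).mulVec_eigenvectorBasis i) s
  simpa [eig, eigBasis] using this

theorem entropy_eq (Λ : Finset ℤ) : φ.entropy Λ = ∑ i, Real.negMulLog (φ.eig Λ i) := by
  rw [entropy, (φ.isHermitian_density Λ).cfc_eq, Matrix.IsHermitian.cfc,
    Unitary.conjStarAlgAut_apply, Matrix.trace_mul_comm, ← mul_assoc]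
  simp [Matrix.trace, eig, -Complex.ofReal_sum]

theorem toPos_ketBra_eigBasis (Λ : Finset ℤ) (i j : Λ → Fin d) :
    φ.toPos (matHom Λ (ketBra (φ.eigBasis Λ i) (φ.eigBasis Λ j))) =
      if i = j then (φ.eig Λ i : ℂ) else 0 := by
  rw [toPos_matHom_ketBra, density_eigBasis, inner_smul_right,
    orthonormal_iff_ite.1 (φ.eigBasis Λ).orthonormal]
  simp [eq_comm]

theorem toPos_star_mul_nonneg (x : Obs d) : 0 ≤ φ.toPos (star x * x) :=
  map_nonneg φ.toPos (star_mul_self_nonneg x)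

theorem eig_nonneg (Λ : Finset ℤ) (i : Λ → Fin d) : 0 ≤ φ.eig Λ i := by
  have h := φ.toPos_star_mul_nonneg (matHom Λ (ketBra (φ.eigBasis Λ i) (φ.eigBasis Λ i)))
  rw [← map_star, star_ketBra, ← map_mul, ketBra_mul_ketBra,
    inner_self_eq_norm_sq_to_K, (φ.eigBasis Λ).orthonormal.1 i] at h
  simp only [RCLike.ofReal_one, one_pow, one_smul, toPos_ketBra_eigBasis, if_true] at h
  exact_mod_cast h

theorem sum_eig (Λ : Finset ℤ) : ∑ i, φ.eig Λ i = 1 := by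
  have h := congrArg (fun M => φ.toPos (matHom Λ M)) (sum_ketBra (φ.eigBasis Λ))
  simp only [map_sum, map_one, toPos_ketBra_eigBasis, if_true, φ.map_one'] at h
  exact_mod_cast h

theorem eig_le_one (Λ : Finset ℤ) (i : Λ → Fin d) : φ.eig Λ i ≤ 1 :=
  (Finset.single_le_sum (fun j _ => φ.eig_nonneg Λ j) (Finset.mem_univ i)).trans_eq (φ.sum_eig Λ)

theorem entropy_nonneg (Λ : Finset ℤ) : 0 ≤ φ.entropy Λ := by
  rw [entropy_eq]
  exact Finset.sum_nonneg fun i _ => Real.negMulLog_nonneg (φ.eig_nonneg Λ i) (φ.eig_le_one Λ i)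

/-- The spectral resolution of the density matrix, entrywise. -/
theorem density_eq_sum (Λ : Finset ℤ) (s t : Λ → Fin d) :
    φ.density Λ s t = ∑ i, (φ.eig Λ i : ℂ) * (φ.eigBasis Λ i s * star (φ.eigBasis Λ i t)) := by
  have h : φ.density Λ = ∑ i, (φ.eig Λ i : ℂ) • ketBra (φ.eigBasis Λ i) (φ.eigBasis Λ i) := by
    rw [← mul_one (φ.density Λ), ← sum_ketBra (φ.eigBasis Λ), Finset.mul_sum]
    refine Finset.sum_congr rfl fun i _ => ?_
    rw [mul_ketBra, density_eigBasis]
    ext s t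
    simp [ketBra_apply, mul_assoc]
  conv_lhs => rw [h]
  simp [Matrix.sum_apply, ketBra_apply]

end State

end SpinChain

/-! ### Mutual information of two regions -/

namespace SpinChain

theorem inner_toEuclideanLin {X : Type*} [Fintype X] [DecidableEq X] (T : Matrix X X ℂ)
    (x y : EuclideanSpace ℂ X) :
    ⟪x, T.toEuclideanLin y⟫_ℂ = ∑ s, ∑ t, T s t * (y t * star (x s)) := by
  rw [euclidean_inner_eq_sum]
  refine Finset.sum_congr rfl fun s _ => ?_
  simp only [Matrix.toLpLin_apply, Matrix.mulVec, dotProduct, Finset.mul_sum]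
  exact Finset.sum_congr rfl fun t _ => by ring

namespace State

variable {d : ℕ} [NeZero d] (φ : State d)

theorem toPos_matHom_eq_sum_eig (Λ : Finset ℤ) (T : Matrix (Λ → Fin d) (Λ → Fin d) ℂ) :
    φ.toPos (matHom Λ T) =
      ∑ i, (φ.eig Λ i : ℂ) * ⟪φ.eigBasis Λ i, T.toEuclideanLin (φ.eigBasis Λ i)⟫_ℂ := by
  simp_rw [toPos_matHom, inner_toEuclideanLin, density_eq_sum, Finset.mul_sum]
  rw [Finset.sum_comm_cycle]
  exact Finset.sum_congr rfl fun i _ => Finset.sum_congr rfl fun s _ =>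
    Finset.sum_congr rfl fun t _ => by ring

theorem toPos_ketBra_self (Λ : Finset ℤ) (x : EuclideanSpace ℂ (Λ → Fin d)) :
    φ.toPos (matHom Λ (ketBra x x)) =
      ((∑ i, φ.eig Λ i * ‖⟪x, φ.eigBasis Λ i⟫_ℂ‖ ^ 2 : ℝ) : ℂ) := by
  rw [toPos_matHom_eq_sum_eig]
  push_cast
  refine Finset.sum_congr rfl fun i _ => ?_
  have : (ketBra x x).toEuclideanLin (φ.eigBasis Λ i) = ⟪x, φ.eigBasis Λ i⟫_ℂ • x := by
    ext s
    simp only [Matrix.toLpLin_apply, Matrix.mulVec, dotProduct, ketBra_apply,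
      euclidean_inner_eq_sum, PiLp.smul_apply, smul_eq_mul, Finset.sum_mul]
    exact Finset.sum_congr rfl fun t _ => by ring
  rw [this, inner_smul_right, ← inner_conj_symm (φ.eigBasis Λ i) x, Complex.mul_conj,
    Complex.normSq_eq_norm_sq]
  push_cast
  ring

/-- If the test `T` (with `0 ≤ T ≤ 1`) has expectation at least `1 - δ` in the state `φ` and at
most `q` in the product of the restrictions of `φ` to `Λ₁` and `Λ₂`, then the mutual information
of `Λ₁` and `Λ₂` is bounded below. -/
theorem entropy_union_le_of_test {Λ₁ Λ₂ Λ : Finset ℤ} (hd : Disjoint Λ₁ Λ₂) (hu : Λ₁ ∪ Λ₂ = Λ)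
    {T : Matrix (Λ → Fin d) (Λ → Fin d) ℂ} (hT : T.IsHermitian)
    (hT2 : ∀ x, ‖T.toEuclideanLin x‖ ^ 2 ≤ (⟪x, T.toEuclideanLin x⟫_ℂ).re)
    {δ q K : ℝ} (hK : 1 ≤ K) (hδ : 1 - δ ≤ (φ.toPos (matHom Λ T)).re)
    (hq : (∑ s, ∑ t, T s t *
      (φ.density Λ₁ (splitConfig hd hu t).1 (splitConfig hd hu s).1 *
        φ.density Λ₂ (splitConfig hd hu t).2 (splitConfig hd hu s).2)).re ≤ q) :
    φ.entropy Λ ≤ φ.entropy Λ₁ + φ.entropy Λ₂ - Real.log K * (1 - 2 * (δ + K * q)) + 1 := by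
  -- the product of the restrictions has the eigenbasis `v` with the products of the eigenvalues
  set v := tensorBasis hd hu (φ.eigBasis Λ₁) (φ.eigBasis Λ₂)
  have hvk : ∀ k, v k = tensorVec hd hu (φ.eigBasis Λ₁ k.1) (φ.eigBasis Λ₂ k.2) :=
    tensorBasis_apply hd hu _ _
  set m : (Λ₁ → Fin d) × (Λ₂ → Fin d) → ℝ :=
    fun k => ∑ i, φ.eig Λ i * ‖⟪v k, φ.eigBasis Λ i⟫_ℂ‖ ^ 2 with hm
  -- `m` is a coupling of the two spectral distributions
  have hmk : ∀ k, (m k : ℂ) =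
      φ.toPos (matHom Λ₁ (ketBra (φ.eigBasis Λ₁ k.1) (φ.eigBasis Λ₁ k.1)) *
        matHom Λ₂ (ketBra (φ.eigBasis Λ₂ k.2) (φ.eigBasis Λ₂ k.2))) := fun k => by
    rw [hm, ← φ.toPos_ketBra_self, hvk, matHom_ketBra_tensorVec]
  have hm0 : ∀ k, 0 ≤ m k := fun k => Finset.sum_nonneg fun i _ =>
    mul_nonneg (φ.eig_nonneg Λ i) (by positivity)
  have hm1 : ∀ i, ∑ j, m (i, j) = φ.eig Λ₁ i := fun i => by
    have h : ((∑ j, m (i, j) : ℝ) : ℂ) = φ.eig Λ₁ i := by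
      push_cast
      simp_rw [hmk]
      rw [← map_sum, ← Finset.mul_sum, ← map_sum, sum_ketBra, map_one, mul_one,
        toPos_ketBra_eigBasis, if_pos rfl]
    exact_mod_cast h
  have hm2 : ∀ j, ∑ i, m (i, j) = φ.eig Λ₂ j := fun j => by
    have h : ((∑ i, m (i, j) : ℝ) : ℂ) = φ.eig Λ₂ j := by
      push_cast
      simp_rw [hmk]
      rw [← map_sum, ← Finset.sum_mul, ← map_sum, sum_ketBra, map_one, one_mul,
        toPos_ketBra_eigBasis, if_pos rfl]
    exact_mod_cast h
  have hz1 : ∀ k, φ.eig Λ₁ k.1 = 0 → m k = 0 := fun k hk =>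
    le_antisymm ((Finset.single_le_sum (f := fun j => m (k.1, j)) (fun j _ => hm0 _)
      (Finset.mem_univ k.2)).trans_eq ((hm1 _).trans hk)) (hm0 k)
  have hz2 : ∀ k, φ.eig Λ₂ k.2 = 0 → m k = 0 := fun k hk =>
    le_antisymm ((Finset.single_le_sum (f := fun i => m (i, k.2)) (fun j _ => hm0 _)
      (Finset.mem_univ k.1)).trans_eq ((hm2 _).trans hk)) (hm0 k)
  have key := sum_negMulLog_le_of_test (φ.eigBasis Λ) v (r := φ.eig Λ)
    (s := fun k => φ.eig Λ₁ k.1 * φ.eig Λ₂ k.2) (φ.eig_nonneg Λ)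
    (fun k => mul_nonneg (φ.eig_nonneg _ _) (φ.eig_nonneg _ _)) (φ.sum_eig Λ)
    (by rw [Fintype.sum_prod_type]; simp_rw [← Finset.mul_sum, sum_eig, mul_one, sum_eig])
    (fun i k hk => by
      have : m k = 0 := (mul_eq_zero.1 hk).elim (hz1 k) (hz2 k)
      exact (Finset.sum_eq_zero_iff_of_nonneg fun i _ =>
        mul_nonneg (φ.eig_nonneg Λ i) (by positivity)).1 this i (Finset.mem_univ i))
    (Matrix.isSymmetric_toEuclideanLin_iff.2 hT) hT2 (δ := δ) (q := q) hK
    (by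
      refine hδ.trans_eq ?_
      rw [toPos_matHom_eq_sum_eig]
      simp)
    (by
      refine Eq.trans_le ?_ hq
      have h : ∑ k, ((φ.eig Λ₁ k.1 * φ.eig Λ₂ k.2 : ℝ) : ℂ) * ⟪v k, T.toEuclideanLin (v k)⟫_ℂ =
          ∑ s, ∑ t, T s t *
            (φ.density Λ₁ (splitConfig hd hu t).1 (splitConfig hd hu s).1 *
              φ.density Λ₂ (splitConfig hd hu t).2 (splitConfig hd hu s).2) := by
        simp_rw [inner_toEuclideanLin, density_eq_sum, Finset.sum_mul_sum,
          ← Fintype.sum_prod_type', Finset.mul_sum]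
        rw [Finset.sum_comm]
        refine Finset.sum_congr rfl fun s _ => Finset.sum_congr rfl fun k _ => ?_
        rw [hvk, tensorVec_apply, tensorVec_apply, star_mul']
        push_cast
        ring
      rw [← h]
      simp)
  rw [entropy_eq, entropy_eq, entropy_eq]
  have hlog : ∑ k, m k * Real.log (φ.eig Λ₁ k.1 * φ.eig Λ₂ k.2) =
      ∑ i, φ.eig Λ₁ i * Real.log (φ.eig Λ₁ i) + ∑ j, φ.eig Λ₂ j * Real.log (φ.eig Λ₂ j) := by
    have h : ∀ k, m k * Real.log (φ.eig Λ₁ k.1 * φ.eig Λ₂ k.2) =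
        m k * Real.log (φ.eig Λ₁ k.1) + m k * Real.log (φ.eig Λ₂ k.2) := fun k => by
      by_cases h1 : φ.eig Λ₁ k.1 = 0
      · simp [hz1 k h1]
      by_cases h2 : φ.eig Λ₂ k.2 = 0
      · simp [hz2 k h2]
      rw [Real.log_mul h1 h2, mul_add]
    rw [Finset.sum_congr rfl fun k _ => h k, Finset.sum_add_distrib]
    congr 1
    · rw [Fintype.sum_prod_type]
      simp_rw [← Finset.sum_mul, hm1]
    · rw [Fintype.sum_prod_type_right]
      simp_rw [← Finset.sum_mul, hm2]
  have hS : ∀ Λ, ∑ i, Real.negMulLog (φ.eig Λ i) = - ∑ i, φ.eig Λ i * Real.log (φ.eig Λ i) :=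
    fun Λ => by simp [Real.negMulLog]
  rw [hlog] at key
  rw [hS Λ₁, hS Λ₂]
  linarith

end State

end SpinChain

/-! ### The GNS representation and the decoupled state -/

namespace SpinChain

section Hilbert

variable {H : Type*} [NormedAddCommGroup H] [InnerProductSpace ℂ H]

theorem inner_self_eq_ofReal (x : H) : ⟪x, x⟫_ℂ = ((‖x‖ ^ 2 : ℝ) : ℂ) := by
  rw [inner_self_eq_norm_sq_to_K]
  push_cast
  rfl

/-- `O ^ 2 ≤ O` for `0 ≤ O ≤ 1`, as `O - O ^ 2 = (1 - O) * O * (1 - O) + O * (1 - O) * O`. -/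
theorem norm_sq_apply_le_re_inner {O : H →L[ℂ] H} (h0 : 0 ≤ O) (h1 : O ≤ 1) (x : H) :
    ‖O x‖ ^ 2 ≤ (⟪x, O x⟫_ℂ).re := by
  have hp0 : O.IsPositive := (ContinuousLinearMap.nonneg_iff_isPositive O).1 h0
  have hp1 : (1 - O).IsPositive := h1
  have e1 := hp0.re_inner_nonneg_right (x - O x)
  have e2 := hp1.re_inner_nonneg_right (O x)
  have e3 : ⟪x - O x, O (x - O x)⟫_ℂ + ⟪O x, (1 - O) (O x)⟫_ℂ = ⟪x, O x⟫_ℂ - ⟪O x, O x⟫_ℂ := by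
    have : ⟪x, O (O x)⟫_ℂ = ⟪O x, O x⟫_ℂ := (hp0.isSymmetric x (O x)).symm
    simp only [map_sub, sub_apply, one_apply_eq_self, inner_sub_left,
      inner_sub_right, this]
    ring
  have e4 := congrArg Complex.re e3
  rw [inner_self_eq_ofReal, Complex.add_re, Complex.sub_re, Complex.ofReal_re] at e4
  rw [RCLike.re_to_complex] at e1 e2
  linarith

theorem norm_apply_le_of_le_one {O : H →L[ℂ] H} (h0 : 0 ≤ O) (h1 : O ≤ 1) (x : H) :
    ‖O x‖ ≤ ‖x‖ := by
  have e := norm_sq_apply_le_re_inner h0 h1 x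
  have e2 := (Complex.re_le_norm _).trans (norm_inner_le_norm (𝕜 := ℂ) x (O x))
  rcases (norm_nonneg (O x)).eq_or_lt with h | h
  · rw [← h]; exact norm_nonneg x
  · nlinarith

variable [CompleteSpace H]

theorem _root_.IsStarProjection.norm_sq_apply {P : H →L[ℂ] H} (hP : IsStarProjection P) (x : H) :
    ((‖P x‖ ^ 2 : ℝ) : ℂ) = ⟪x, P x⟫_ℂ := by
  have h1 : ⟪P x, P x⟫_ℂ = ⟪x, P x⟫_ℂ := by
    have h2 := ContinuousLinearMap.adjoint_inner_right P x (P x)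
    rw [← ContinuousLinearMap.star_eq_adjoint, hP.isSelfAdjoint.star_eq,
      ← mul_apply_eq_comp, hP.isIdempotentElem.eq] at h2
    exact h2.symm
  rw [← h1, inner_self_eq_ofReal]

theorem _root_.IsStarProjection.norm_apply_le {P : H →L[ℂ] H} (hP : IsStarProjection P) (x : H) :
    ‖P x‖ ≤ ‖x‖ :=
  norm_apply_le_of_le_one hP.nonneg hP.le_one x

theorem _root_.IsStarProjection.norm_sub_sq {P : H →L[ℂ] H} (hP : IsStarProjection P) (x : H) :
    ‖x - P x‖ ^ 2 = ‖x‖ ^ 2 - ‖P x‖ ^ 2 := by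
  have h := hP.norm_sq_apply x
  rw [@_root_.norm_sub_sq ℂ, ← h]
  simp only [RCLike.re_to_complex, Complex.ofReal_re]
  ring

end Hilbert

variable {d : ℕ} [NeZero d]

namespace State

variable (φ : State d)

theorem gnsRep_gnsVec (x : Obs d) :
    φ.gnsRep x φ.gnsVec = ((φ.toPos.toPreGNS x : φ.toPos.PreGNS) : φ.gnsSpace) := by
  simp [gnsVec, gnsRep]

theorem inner_gnsVec (x : Obs d) : ⟪φ.gnsVec, φ.gnsRep x φ.gnsVec⟫_ℂ = φ.toPos x := by
  rw [gnsRep_gnsVec, gnsVec, UniformSpace.Completion.inner_coe,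
    PositiveLinearMap.preGNS_inner_def]
  simp

theorem norm_gnsVec : ‖φ.gnsVec‖ = 1 := by
  have h := φ.inner_gnsVec 1
  rw [map_one, φ.map_one', one_apply_eq_self, inner_self_eq_ofReal] at h
  have h2 : ‖φ.gnsVec‖ ^ 2 = 1 := by exact_mod_cast h
  exact (pow_eq_one_iff_of_nonneg (norm_nonneg _) two_ne_zero).1 h2

/-- The representation of the matrix algebra of a finite region on the GNS space. -/
def rep (Λ : Finset ℤ) :
    Matrix (Λ → Fin d) (Λ → Fin d) ℂ →⋆ₐ[ℂ] (φ.gnsSpace →L[ℂ] φ.gnsSpace) :=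
  φ.gnsRep.comp (matHom Λ)

theorem rep_apply (Λ : Finset ℤ) (M : Matrix (Λ → Fin d) (Λ → Fin d) ℂ) :
    φ.rep Λ M = φ.gnsRep (matHom Λ M) := rfl

theorem inner_rep (Λ : Finset ℤ) (M : Matrix (Λ → Fin d) (Λ → Fin d) ℂ) :
    ⟪φ.gnsVec, φ.rep Λ M φ.gnsVec⟫_ℂ = φ.toPos (matHom Λ M) := φ.inner_gnsVec _

theorem mem_repLocal_iff (Λ : Finset ℤ) (x : φ.gnsSpace →L[ℂ] φ.gnsSpace) :
    x ∈ φ.repLocal (Λ : Set ℤ) ↔ ∃ M, φ.rep Λ M = x := by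
  constructor
  · rintro ⟨y, hy, rfl⟩
    obtain ⟨M, rfl⟩ := (mem_localAlg_iff _ _).1 hy
    exact ⟨M, rfl⟩
  · rintro ⟨M, rfl⟩
    exact ⟨matHom Λ M, (mem_localAlg_iff _ _).2 ⟨M, rfl⟩, rfl⟩

theorem inner_rep_apply (Λ : Finset ℤ) (M : Matrix (Λ → Fin d) (Λ → Fin d) ℂ)
    (x y : φ.gnsSpace) : ⟪φ.rep Λ M x, y⟫_ℂ = ⟪x, φ.rep Λ (star M) y⟫_ℂ := by
  rw [map_star, ContinuousLinearMap.star_eq_adjoint, ContinuousLinearMap.adjoint_inner_right]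

/-- The representation of a full matrix algebra contains the defining representation. This carries
operator inequalities in the GNS space over to matrices. -/
theorem exists_intertwiner (Λ : Finset ℤ) :
    ∃ V : EuclideanSpace ℂ (Λ → Fin d) → φ.gnsSpace, (∀ x y, ⟪V x, V y⟫_ℂ = ⟪x, y⟫_ℂ) ∧
      ∀ T x, φ.rep Λ T (V x) = V (T.toEuclideanLin x) := by
  obtain ⟨i, hi⟩ : ∃ i, φ.rep Λ (ketBra (φ.eigBasis Λ i) (φ.eigBasis Λ i)) φ.gnsVec ≠ 0 := by
    by_contra! h
    have h2 := congrArg (fun M => φ.rep Λ M φ.gnsVec) (sum_ketBra (φ.eigBasis Λ))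
    simp only [map_sum, sum_apply, h, Finset.sum_const_zero, map_one,
      one_apply_eq_self] at h2
    have := φ.norm_gnsVec
    rw [← h2, norm_zero] at this
    exact zero_ne_one this
  set e := φ.eigBasis Λ i with he
  set w := φ.rep Λ (ketBra e e) φ.gnsVec with hw
  have hee : ⟪e, e⟫_ℂ = 1 := by
    rw [inner_self_eq_ofReal, he, (φ.eigBasis Λ).orthonormal.1 i]; simp
  refine ⟨fun x => ((‖w‖⁻¹ : ℝ) : ℂ) • φ.rep Λ (ketBra x e) w, fun x y => ?_, fun T x => ?_⟩
  · rw [inner_smul_left, inner_smul_right, inner_rep_apply, star_ketBra, ← mul_apply_eq_comp,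
      ← map_mul, ketBra_mul_ketBra, map_smul, smul_apply, inner_smul_right]
    have h1 : φ.rep Λ (ketBra e e) w = w := by
      rw [hw, ← mul_apply_eq_comp, ← map_mul, ketBra_mul_ketBra, hee, one_smul]
    have h2 : (‖w‖ : ℂ) ≠ 0 := by simpa using norm_ne_zero_iff.2 hi
    rw [h1, inner_self_eq_ofReal, Complex.conj_ofReal]
    push_cast
    field_simp
  · rw [map_smul, ← mul_apply_eq_comp, ← map_mul, mul_ketBra]

theorem isHermitian_of_rep {Λ : Finset ℤ} {T : Matrix (Λ → Fin d) (Λ → Fin d) ℂ}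
    (h0 : 0 ≤ φ.rep Λ T) : T.IsHermitian := by
  obtain ⟨V, hV, hT⟩ := φ.exists_intertwiner Λ
  rw [← Matrix.isSymmetric_toEuclideanLin_iff]
  intro x y
  rw [← hV, ← hV, ← hT, ← hT]
  exact ((ContinuousLinearMap.nonneg_iff_isPositive _).1 h0).isSymmetric _ _

theorem norm_sq_le_of_rep {Λ : Finset ℤ} {T : Matrix (Λ → Fin d) (Λ → Fin d) ℂ}
    (h0 : 0 ≤ φ.rep Λ T) (h1 : φ.rep Λ T ≤ 1) (x : EuclideanSpace ℂ (Λ → Fin d)) :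
    ‖T.toEuclideanLin x‖ ^ 2 ≤ (⟪x, T.toEuclideanLin x⟫_ℂ).re := by
  obtain ⟨V, hV, hT⟩ := φ.exists_intertwiner Λ
  have hn : ∀ y, ‖V y‖ = ‖y‖ := fun y => by
    rw [@norm_eq_sqrt_re_inner ℂ, hV, ← @norm_eq_sqrt_re_inner ℂ]
  have := norm_sq_apply_le_re_inner h0 h1 (V x)
  rwa [hT, hn, hV] at this

/-- The product of the restrictions of `φ` to `𝔄_I` and to its commutant, as a normal functional
on the bounded operators of the GNS space. It is a sum of vector functionals: if `Ω` has the Schmidt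
decomposition `∑ i, √(eig i) • (u i ⊗ f i)`, then `√(eig i) • (|u i⟩⟨u j|) Ω` is
`√(eig i * eig j) • (u i ⊗ f j)`. -/
def decoupled (I : Finset ℤ) (x : φ.gnsSpace →L[ℂ] φ.gnsSpace) : ℂ :=
  ∑ i, ∑ j, (φ.eig I i : ℂ) *
    ⟪φ.rep I (ketBra (φ.eigBasis I i) (φ.eigBasis I j)) φ.gnsVec,
      x (φ.rep I (ketBra (φ.eigBasis I i) (φ.eigBasis I j)) φ.gnsVec)⟫_ℂ

/-- The functional `decoupled I` is multiplicative across `𝔄_I` and its commutant. -/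
theorem decoupled_mul (I : Finset ℤ) (M : Matrix (I → Fin d) (I → Fin d) ℂ)
    {z : φ.gnsSpace →L[ℂ] φ.gnsSpace} (hz : ∀ N, Commute (φ.rep I N) z) :
    φ.decoupled I (φ.rep I M * z) = φ.toPos (matHom I M) * ⟪φ.gnsVec, z φ.gnsVec⟫_ℂ := by
  have h1 : ∀ i j, ⟪φ.rep I (ketBra (φ.eigBasis I i) (φ.eigBasis I j)) φ.gnsVec,
      (φ.rep I M * z) (φ.rep I (ketBra (φ.eigBasis I i) (φ.eigBasis I j)) φ.gnsVec)⟫_ℂ =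
      ⟪φ.eigBasis I i, M.toEuclideanLin (φ.eigBasis I i)⟫_ℂ *
        ⟪φ.gnsVec, φ.rep I (ketBra (φ.eigBasis I j) (φ.eigBasis I j)) (z φ.gnsVec)⟫_ℂ := by
    intro i j
    rw [inner_rep_apply, star_ketBra, ← mul_apply_eq_comp (φ.rep I M * z), mul_assoc,
      ← (hz _).eq, ← mul_apply_eq_comp, ← mul_assoc, ← mul_assoc, ← map_mul, ← map_mul,
      ketBra_mul_mul_ketBra, map_smul, smul_mul_assoc, smul_apply, inner_smul_right,
      mul_apply_eq_comp]
  simp_rw [decoupled, h1]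
  rw [toPos_matHom_eq_sum_eig, Finset.sum_mul]
  refine Finset.sum_congr rfl fun i _ => ?_
  simp_rw [← mul_assoc]
  rw [← Finset.mul_sum, ← inner_sum, ← sum_apply, ← map_sum, sum_ketBra, map_one,
    one_apply_eq_self]

end State

end SpinChain

/-! ### Decrement of the entropy -/

namespace SpinChain

section Hilbert

variable {H : Type*} [NormedAddCommGroup H] [InnerProductSpace ℂ H]

/-- If `O * Q` is close to the projection onto the unit vector `Ω`, where `0 ≤ O ≤ 1`, then `Q`
almost preserves the norm of `Ω`. -/
theorem le_norm_apply_of_norm_sub_le {O Q : H →L[ℂ] H} {Ω : H} (hΩ : ‖Ω‖ = 1) (h0 : 0 ≤ O)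
    (h1 : O ≤ 1) {ε : ℝ} (h : ‖O * Q - InnerProductSpace.rankOne ℂ Ω Ω‖ ≤ ε) :
    1 - ε ≤ ‖Q Ω‖ := by
  have e1 := (O * Q - InnerProductSpace.rankOne ℂ Ω Ω).le_of_opNorm_le h Ω
  rw [sub_apply, InnerProductSpace.rankOne_apply, inner_self_eq_ofReal, hΩ] at e1
  simp only [mul_apply_eq_comp, one_pow, Complex.ofReal_one, one_smul, mul_one] at e1
  have e2 := norm_sub_norm_le Ω (O (Q Ω))
  rw [norm_sub_rev] at e2
  linarith [norm_apply_le_of_le_one h0 h1 (Q Ω)]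

variable [CompleteSpace H]

theorem re_inner_ge_of_norm_sub_le {O Q : H →L[ℂ] H} {Ω : H} (hΩ : ‖Ω‖ = 1) (h0 : 0 ≤ O)
    (h1 : O ≤ 1) (hQ : IsStarProjection Q) {ε : ℝ} (hε : 0 < ε) (hε1 : ε ≤ 1)
    (h : ‖O * Q - InnerProductSpace.rankOne ℂ Ω Ω‖ ≤ ε) :
    1 - 3 * √ε ≤ (⟪Ω, O Ω⟫_ℂ).re := by
  have hs := Real.sqrt_nonneg ε
  have hs2 := Real.sq_sqrt hε.le
  have hs1 : √ε ≤ 1 := Real.sqrt_le_one.2 hε1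
  have e1 := (O * Q - InnerProductSpace.rankOne ℂ Ω Ω).le_of_opNorm_le h Ω
  rw [sub_apply, InnerProductSpace.rankOne_apply, inner_self_eq_ofReal, hΩ] at e1
  simp only [mul_apply_eq_comp, one_pow, Complex.ofReal_one, one_smul, mul_one] at e1
  have e2 : ‖O Ω - O (Q Ω)‖ ≤ 2 * √ε := by
    rw [← map_sub]
    refine (norm_apply_le_of_le_one h0 h1 _).trans ?_
    refine abs_le_of_sq_le_sq' ?_ (by positivity) |>.2
    rw [hQ.norm_sub_sq, hΩ]
    have := le_norm_apply_of_norm_sub_le hΩ h0 h1 h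
    nlinarith
  have e3 : ‖Ω - O Ω‖ ≤ ε + 2 * √ε := by
    calc ‖Ω - O Ω‖ = ‖-(O (Q Ω) - Ω) - (O Ω - O (Q Ω))‖ := by congr 1; abel
      _ ≤ ‖O (Q Ω) - Ω‖ + ‖O Ω - O (Q Ω)‖ := by
          refine (norm_sub_le _ _).trans ?_
          rw [norm_neg]
      _ ≤ _ := by linarith
  have e4 := (Complex.re_le_norm _).trans (norm_inner_le_norm (𝕜 := ℂ) Ω (Ω - O Ω))
  rw [inner_sub_right, inner_self_eq_ofReal, hΩ, Complex.sub_re, Complex.ofReal_re] at e4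
  nlinarith

end Hilbert

variable {d : ℕ} [NeZero d]

namespace State

variable (φ : State d)

theorem decoupled_sub (I : Finset ℤ) (x y : φ.gnsSpace →L[ℂ] φ.gnsSpace) :
    φ.decoupled I (x - y) = φ.decoupled I x - φ.decoupled I y := by
  simp only [decoupled, sub_apply, inner_sub_right, mul_sub, Finset.sum_sub_distrib]

theorem decoupled_sum (I : Finset ℤ) {ι : Type*} (s : Finset ι)
    (x : ι → φ.gnsSpace →L[ℂ] φ.gnsSpace) :
    φ.decoupled I (∑ a ∈ s, x a) = ∑ a ∈ s, φ.decoupled I (x a) := by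
  simp only [decoupled, sum_apply, inner_sum, Finset.mul_sum]
  rw [Finset.sum_comm_cycle]

theorem decoupled_smul (I : Finset ℤ) (c : ℂ) (x : φ.gnsSpace →L[ℂ] φ.gnsSpace) :
    φ.decoupled I (c • x) = c * φ.decoupled I x := by
  simp only [decoupled, smul_apply, inner_smul_right, Finset.mul_sum]
  exact Finset.sum_congr rfl fun i _ => Finset.sum_congr rfl fun j _ => by ring

theorem decoupled_one (I : Finset ℤ) : φ.decoupled I 1 = 1 := by
  have h := φ.decoupled_mul I 1 (z := 1) fun N => Commute.one_right _
  rwa [map_one, map_one, mul_one, φ.map_one', one_apply_eq_self, inner_self_eq_ofReal,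
    norm_gnsVec, one_pow, Complex.ofReal_one, mul_one] at h

theorem decoupled_groundProj (I : Finset ℤ) :
    φ.decoupled I φ.groundProj = ((∑ i, φ.eig I i ^ 3 : ℝ) : ℂ) := by
  rw [decoupled]
  push_cast
  refine Finset.sum_congr rfl fun i _ => ?_
  have h : ∀ j, ⟪φ.rep I (ketBra (φ.eigBasis I i) (φ.eigBasis I j)) φ.gnsVec,
      φ.groundProj (φ.rep I (ketBra (φ.eigBasis I i) (φ.eigBasis I j)) φ.gnsVec)⟫_ℂ =
      if i = j then (φ.eig I i : ℂ) ^ 2 else 0 := fun j => by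
    rw [groundProj, InnerProductSpace.rankOne_apply, inner_smul_right, ← inner_conj_symm _ φ.gnsVec,
      inner_rep, toPos_ketBra_eigBasis]
    split_ifs <;> simp [sq]
  simp_rw [h, mul_ite, mul_zero]
  rw [Finset.sum_ite_eq, if_pos (Finset.mem_univ _)]
  ring

/-- A bound for the quadratic form of `x` is a bound for its expectation, since `decoupled I` is a
sum of vector functionals of total mass one. -/
theorem re_decoupled_le (I : Finset ℤ) {ε : ℝ} {x : φ.gnsSpace →L[ℂ] φ.gnsSpace}
    (h : ∀ ψ, (⟪ψ, x ψ⟫_ℂ).re ≤ ε * ‖ψ‖ ^ 2) : (φ.decoupled I x).re ≤ ε := by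
  have h1 := congrArg Complex.re (φ.decoupled_one I)
  simp only [decoupled, one_apply_eq_self, inner_self_eq_ofReal, Complex.re_sum,
    Complex.re_ofReal_mul, Complex.ofReal_re, Complex.one_re] at h1 ⊢
  rw [← mul_one ε, ← h1, Finset.mul_sum]
  refine Finset.sum_le_sum fun i _ => ?_
  rw [Finset.mul_sum]
  refine Finset.sum_le_sum fun j _ => ?_
  have := mul_le_mul_of_nonneg_left
    (h (φ.rep I (ketBra (φ.eigBasis I i) (φ.eigBasis I j)) φ.gnsVec)) (φ.eig_nonneg I i)
  linarith

/-- In the decoupled state, an operator `O` such that `O * R * L` is close to the projection onto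
`Ω` has small expectation if the spectrum of the density matrix of `I` is small. -/
theorem re_decoupled_le_of_norm_sub_le (I : Finset ℤ) {O L : φ.gnsSpace →L[ℂ] φ.gnsSpace}
    {M : Matrix (I → Fin d) (I → Fin d) ℂ} (h0 : 0 ≤ O) (h1 : O ≤ 1)
    (hR : IsStarProjection (φ.rep I M)) (hL : IsStarProjection L)
    (hLI : ∀ N, Commute (φ.rep I N) L) {ε : ℝ} (hε : 0 < ε) (hε1 : ε ≤ 1)
    (h : ‖O * (φ.rep I M * L) - φ.groundProj‖ ≤ ε) (hI : ∀ i, φ.eig I i ^ 2 ≤ ε) :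
    (φ.decoupled I O).re ≤ 5 * √ε := by
  have hs : 0 < √ε := Real.sqrt_pos.2 hε
  have hs2 := Real.sq_sqrt hε.le
  have hs1 : √ε ≤ 1 := Real.sqrt_le_one.2 hε1
  set R := φ.rep I M with hRdef
  set Q := R * L with hQdef
  have hQ : IsStarProjection Q := hR.mul hL (hLI M)
  have hΩ := φ.norm_gnsVec
  have hQn := le_norm_apply_of_norm_sub_le hΩ h0 h1 h
  have hLn : 1 - ε ≤ ‖L φ.gnsVec‖ := hQn.trans (hR.norm_apply_le _)
  -- `R` and `L` commute, so each of them may be applied last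
  have hRn : 1 - ε ≤ ‖R φ.gnsVec‖ := by
    have e : Q = L * R := hLI M
    rw [e] at hQn
    exact hQn.trans (hL.norm_apply_le _)
  have hprod : (φ.decoupled I (1 - Q)).re ≤ 4 * ε := by
    rw [decoupled_sub, decoupled_one, hQdef, hRdef, φ.decoupled_mul I M hLI, ← inner_rep,
      ← hR.norm_sq_apply, ← hL.norm_sq_apply, ← Complex.ofReal_mul, Complex.sub_re,
      Complex.ofReal_re, Complex.one_re]
    have e1 : (1 - ε) ^ 2 ≤ ‖R φ.gnsVec‖ ^ 2 := pow_le_pow_left₀ (by linarith) hRn 2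
    have e2 : (1 - ε) ^ 2 ≤ ‖L φ.gnsVec‖ ^ 2 := pow_le_pow_left₀ (by linarith) hLn 2
    have e3 := mul_le_mul e1 e2 (by positivity) (by positivity)
    have e4 : 1 - 4 * ε ≤ (1 - ε) ^ 2 * (1 - ε) ^ 2 := by nlinarith [sq_nonneg (ε * (2 - ε))]
    linarith
  have hA : (φ.decoupled I (O * Q - φ.groundProj)).re ≤ ε := by
    refine φ.re_decoupled_le I fun ψ => ?_
    refine (Complex.re_le_norm _).trans ((norm_inner_le_norm _ _).trans ?_)
    have := (O * Q - φ.groundProj).le_of_opNorm_le h ψ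
    nlinarith [norm_nonneg ψ]
  have hB : (φ.decoupled I φ.groundProj).re ≤ ε := by
    rw [decoupled_groundProj, Complex.ofReal_re]
    calc ∑ i, φ.eig I i ^ 3 ≤ ∑ i, ε * φ.eig I i := Finset.sum_le_sum fun i _ => by
          have := mul_le_mul_of_nonneg_right (hI i) (φ.eig_nonneg I i)
          nlinarith
      _ = ε := by rw [← Finset.mul_sum, sum_eig, mul_one]
  -- the arithmetic-geometric mean inequality replaces the Cauchy-Schwarz inequality
  have hC : (φ.decoupled I (O * (1 - Q) - (((2 * √ε)⁻¹ : ℝ) : ℂ) • (1 - Q))).re ≤ √ε / 2 := by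
    refine φ.re_decoupled_le I fun ψ => ?_
    have e1 : (⟪ψ, (1 - Q) ψ⟫_ℂ) = ((‖(1 - Q) ψ‖ ^ 2 : ℝ) : ℂ) :=
      (hQ.one_sub.norm_sq_apply ψ).symm
    have e2 := (Complex.re_le_norm _).trans (norm_inner_le_norm (𝕜 := ℂ) ψ (O ((1 - Q) ψ)))
    have e3 := mul_le_mul_of_nonneg_left (norm_apply_le_of_le_one h0 h1 ((1 - Q) ψ))
      (norm_nonneg ψ)
    rw [sub_apply, inner_sub_right, smul_apply, inner_smul_right, e1, mul_apply_eq_comp,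
      Complex.sub_re, Complex.re_ofReal_mul, Complex.ofReal_re]
    have e4 : ‖ψ‖ * ‖(1 - Q) ψ‖ ≤ √ε / 2 * ‖ψ‖ ^ 2 + (2 * √ε)⁻¹ * ‖(1 - Q) ψ‖ ^ 2 := by
      have := sq_nonneg (√ε * ‖ψ‖ - ‖(1 - Q) ψ‖)
      have e5 : √ε / 2 * ‖ψ‖ ^ 2 + (2 * √ε)⁻¹ * ‖(1 - Q) ψ‖ ^ 2 - ‖ψ‖ * ‖(1 - Q) ψ‖ =
          (2 * √ε)⁻¹ * (√ε * ‖ψ‖ - ‖(1 - Q) ψ‖) ^ 2 := by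
        field_simp
        ring
      have e6 : 0 ≤ (2 * √ε)⁻¹ * (√ε * ‖ψ‖ - ‖(1 - Q) ψ‖) ^ 2 := by positivity
      linarith
    linarith
  rw [decoupled_sub] at hA hC
  rw [Complex.sub_re] at hA hC
  rw [decoupled_smul, Complex.re_ofReal_mul] at hC
  have e : φ.decoupled I O = φ.decoupled I (O * Q) + φ.decoupled I (O * (1 - Q)) := by
    have := φ.decoupled_sub I O (O * (1 - Q))
    rw [mul_sub, mul_one, sub_sub_cancel] at this
    rw [this, mul_sub, mul_one]
    ring
  rw [e, Complex.add_re]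
  have e7 : (2 * √ε)⁻¹ * (φ.decoupled I (1 - Q)).re ≤ 2 * √ε := by
    calc _ ≤ (2 * √ε)⁻¹ * (4 * ε) := mul_le_mul_of_nonneg_left hprod (by positivity)
      _ = (2 * √ε)⁻¹ * (4 * √ε ^ 2) := by rw [hs2]
      _ = 2 * √ε := by field_simp; ring
  nlinarith

/-- Decrement of entropy: if `φ` is almost a product of a projection in `𝔄_I`, a projection
commuting with `𝔄_I` and an operator `O` in `𝔄_Λ`, and the spectrum of the density matrix of `I`
is small, then the mutual information between the parts of `Λ` inside and outside of `I` is
large. -/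
theorem entropy_union_le_of_factorization {I Λ₁ Λ₂ Λ : Finset ℤ} (hd : Disjoint Λ₁ Λ₂)
    (hu : Λ₁ ∪ Λ₂ = Λ) (h₁ : Λ₁ ⊆ I) (h₂ : Disjoint I Λ₂)
    {O R L : φ.gnsSpace →L[ℂ] φ.gnsSpace} (hO : O ∈ φ.repLocal Λ) (h0 : 0 ≤ O) (h1 : O ≤ 1)
    (hRI : R ∈ φ.repLocal I) (hR : IsStarProjection R) (hL : IsStarProjection L)
    (hLI : ∀ N, Commute (φ.rep I N) L) {ε K : ℝ} (hε : 0 < ε) (hε1 : ε ≤ 1) (hK : 1 ≤ K)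
    (h : ‖O * R * L - φ.groundProj‖ ≤ ε) (hI : ∀ i, φ.eig I i ^ 2 ≤ ε) :
    φ.entropy Λ ≤ φ.entropy Λ₁ + φ.entropy Λ₂ -
      Real.log K * (1 - 2 * (3 * √ε + K * (5 * √ε))) + 1 := by
  obtain ⟨T, rfl⟩ := (φ.mem_repLocal_iff Λ O).1 hO
  obtain ⟨M, rfl⟩ := (φ.mem_repLocal_iff I R).1 hRI
  rw [mul_assoc] at h
  refine φ.entropy_union_le_of_test hd hu (φ.isHermitian_of_rep h0) (φ.norm_sq_le_of_rep h0 h1)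
    hK ?_ ?_
  · rw [← inner_rep]
    exact re_inner_ge_of_norm_sub_le φ.norm_gnsVec h0 h1 (hR.mul hL (hLI M)) hε hε1 h
  · refine Eq.trans_le ?_
      (φ.re_decoupled_le_of_norm_sub_le I h0 h1 hR hL hLI hε hε1 h hI)
    congr 1
    rw [rep_apply, matHom_apply]
    simp_rw [map_sum, map_smul, decoupled_sum, decoupled_smul]
    refine Finset.sum_congr rfl fun s _ => Finset.sum_congr rfl fun t _ => ?_
    congr 1
    obtain ⟨N, hN⟩ := exists_matHom_eq_of_subset h₁
      (Matrix.single (splitConfig hd hu s).1 (splitConfig hd hu t).1 (1 : ℂ))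
    rw [matHom_single] at hN
    have hcomm : ∀ N, Commute (φ.rep I N)
        (φ.gnsRep (matUnit Λ₂ (splitConfig hd hu s).2 (splitConfig hd hu t).2)) := fun N => by
      exact (commute_of_mem_localAlg (Λ₂ := Λ₂) (Finset.disjoint_coe.2 h₂)
        ((mem_localAlg_iff _ _).2 ⟨N, rfl⟩)
        ((mem_localAlg_iff _ _).2 ⟨_, matHom_single _ _ _⟩)).map φ.gnsRep
    rw [matUnit_split hd hu, map_mul, ← hN, ← rep_apply, φ.decoupled_mul I N hcomm, inner_gnsVec,
      hN]
    rfl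

end State

end SpinChain

/-! ### A lower bound for the largest eigenvalue -/

namespace SpinChain

namespace State

variable {d : ℕ} [NeZero d] (φ : State d)

/-- The approximate factorization of the projection onto the GNS vector along both ends of every
interval, with error `C₁ * exp (-C₂ * l)` at scale `l`. -/
def Factorizes (C₁ C₂ : ℝ) : Prop :=
  ∀ (m : ℤ) (n l : ℕ), 0 < l → 8 * l < n →
    ∃ O_B O_R O_L : φ.gnsSpace →L[ℂ] φ.gnsSpace,
      O_R ∈ φ.repLocal (Set.Icc m (m + n - 1)) ∧ IsStarProjection O_R ∧
      O_L ∈ φ.repVN (Set.Icc m (m + n - 1))ᶜ ∧ IsStarProjection O_L ∧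
      O_B ∈ φ.repLocal (Set.Ioo (m - l) (m + l) ∪ Set.Ioo (m + n - l) (m + n + l)) ∧
      0 ≤ O_B ∧ O_B ≤ 1 ∧
      ‖O_B * O_R * O_L - φ.groundProj‖ ≤ C₁ * Real.exp (-C₂ * l)

/-- The blocks of `l` sites on either side of each end of the interval `[x, y)`. -/
def endpointWindow (x y : ℤ) (l : ℕ) : Finset ℤ :=
  Finset.Ico (x - l) (x + l) ∪ Finset.Ico (y - l) (y + l)

theorem commute_rep_of_mem_repVN {I : Finset ℤ} {J : Set ℤ} (h : Disjoint (I : Set ℤ) J)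
    {L : φ.gnsSpace →L[ℂ] φ.gnsSpace} (hL : L ∈ φ.repVN J) (N) : Commute (φ.rep I N) L := by
  refine hL (φ.rep I N) ?_
  rintro _ ⟨y, hy, rfl⟩
  exact ((commute_of_mem_localAlg h ((mem_localAlg_iff _ _).2 ⟨N, rfl⟩) hy).map φ.gnsRep).symm

variable {φ}

/-- The operators of the factorization at scale `l` for the interval `[x, y)`. The window of the
operator `O` is enlarged to blocks of equal length. -/
theorem Factorizes.exists_operators {C₁ C₂ : ℝ} (h : φ.Factorizes C₁ C₂) {x y : ℤ} {l : ℕ}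
    (hl : 0 < l) (hxy : 8 * l < y - x) :
    ∃ O R L : φ.gnsSpace →L[ℂ] φ.gnsSpace,
      R ∈ φ.repLocal (Finset.Ico x y) ∧ IsStarProjection R ∧ IsStarProjection L ∧
      (∀ N, Commute (φ.rep (Finset.Ico x y) N) L) ∧
      O ∈ φ.repLocal (endpointWindow x y l) ∧ 0 ≤ O ∧ O ≤ 1 ∧
      ‖O * R * L - φ.groundProj‖ ≤ C₁ * Real.exp (-C₂ * l) := by
  obtain ⟨n, rfl⟩ : ∃ n : ℕ, y = x + n := ⟨(y - x).toNat, by omega⟩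
  obtain ⟨O, R, L, hR, hRp, hL, hLp, hO, h0, h1, hn⟩ := h x n l hl (by omega)
  have hI : Set.Icc x (x + n - 1) = (Finset.Ico x (x + n) : Finset ℤ) := by
    ext j; simp
  rw [hI] at hR hL
  refine ⟨O, R, L, hR, hRp, hLp, φ.commute_rep_of_mem_repVN disjoint_compl_right hL, ?_, h0, h1, hn⟩
  refine Set.image_mono (localAlg_mono ?_) hO
  intro j
  simp [endpointWindow]
  omega

variable (φ)

/-- Each eigenvalue of the density matrix of a smaller region is a sum of `d ^ k` expectations of
one-dimensional projections of the larger region, where `k` is the number of additional sites. -/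
theorem eig_le_of_subset {I J : Finset ℤ} (h : J ⊆ I) {c : ℝ} (hc : ∀ i, φ.eig I i ≤ c)
    (i : J → Fin d) : φ.eig J i ≤ d ^ (I \ J).card * c := by
  have hd : Disjoint J (I \ J) := Finset.disjoint_sdiff
  have hu : J ∪ (I \ J) = I := Finset.union_sdiff_of_subset h
  have h1 : (φ.eig J i : ℂ) = ((∑ j, ∑ k, φ.eig I k * ‖⟪tensorVec hd hu (φ.eigBasis J i)
      (φ.eigBasis (I \ J) j), φ.eigBasis I k⟫_ℂ‖ ^ 2 : ℝ) : ℂ) := by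
    have h2 := φ.toPos_ketBra_eigBasis J i i
    rw [if_pos rfl, ← mul_one (matHom J _), ← map_one (matHom (I \ J)),
      ← sum_ketBra (φ.eigBasis (I \ J)), map_sum, Finset.mul_sum, map_sum] at h2
    rw [← h2, Complex.ofReal_sum]
    refine Finset.sum_congr rfl fun j _ => ?_
    rw [← matHom_ketBra_tensorVec hd hu, toPos_ketBra_self]
  rw [Complex.ofReal_inj] at h1
  rw [h1]
  calc _ ≤ ∑ j : ((I \ J : Finset ℤ) → Fin d), c := by
        refine Finset.sum_le_sum fun j _ => ?_
        set v := tensorVec hd hu (φ.eigBasis J i) (φ.eigBasis (I \ J) j) with hv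
        have hv1 : ‖v‖ ^ 2 = 1 := by
          have := inner_tensorVec hd hu (φ.eigBasis J i) (φ.eigBasis J i) (φ.eigBasis (I \ J) j)
            (φ.eigBasis (I \ J) j)
          rw [inner_self_eq_ofReal, inner_self_eq_ofReal, inner_self_eq_ofReal,
            (φ.eigBasis J).orthonormal.1 i, (φ.eigBasis (I \ J)).orthonormal.1 j] at this
          rwa [← hv, one_pow, Complex.ofReal_one, mul_one, Complex.ofReal_eq_one] at this
        calc _ ≤ ∑ k, c * ‖⟪v, φ.eigBasis I k⟫_ℂ‖ ^ 2 :=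
              Finset.sum_le_sum fun k _ => mul_le_mul_of_nonneg_right (hc k) (by positivity)
          _ = c := by
              rw [← Finset.mul_sum, (φ.eigBasis I).sum_sq_norm_inner_left, hv1, mul_one]
    _ = d ^ (I \ J).card * c := by simp

/-- A crude form of the bound of the entropy by the logarithm of the dimension. -/
theorem entropy_le_card_mul_log (Λ : Finset ℤ) : φ.entropy Λ ≤ Λ.card * Real.log d + 1 := by
  have hd : (0 : ℝ) < d := by exact_mod_cast NeZero.pos d
  rw [entropy_eq]
  have hD : (0 : ℝ) < d ^ Λ.card := by positivity
  calc ∑ i, Real.negMulLog (φ.eig Λ i)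
      ≤ ∑ i : Λ → Fin d, (φ.eig Λ i * (Λ.card * Real.log d) + ((d : ℝ) ^ Λ.card)⁻¹) := by
        refine Finset.sum_le_sum fun i _ => ?_
        have h := negMulLog_le_of_nonneg (φ.eig_nonneg Λ i) (inv_pos.2 hD) le_rfl
        rw [Real.log_inv, Real.log_pow, Real.log_one] at h
        linarith
    _ = _ := by
        rw [Finset.sum_add_distrib, ← Finset.sum_mul, sum_eig]
        simp

/-- The choice of the likelihood threshold in `entropy_union_le_of_factorization`: at scale `l`
the mutual information is at least a constant multiple of `l`. -/
theorem exists_log_mul_ge {C₁ C₂ : ℝ} (hC₁ : 0 < C₁) (hC₂ : 0 < C₂) :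
    ∃ l₀ : ℕ, 0 < l₀ ∧ ∀ l : ℕ, l₀ ≤ l → C₁ * Real.exp (-C₂ * l) ≤ 1 ∧ ∃ K : ℝ, 1 ≤ K ∧
      C₂ / 16 * l ≤ Real.log K * (1 - 2 * (3 * √(C₁ * Real.exp (-C₂ * l)) +
        K * (5 * √(C₁ * Real.exp (-C₂ * l))))) - 1 := by
  obtain ⟨l₀, hl₀⟩ := exists_nat_ge (max ((2 * Real.log C₁ + 16) / C₂)
    ((Real.log C₁ + 4 * Real.log 32) / C₂))
  refine ⟨l₀ + 1, Nat.succ_pos _, fun l hl => ?_⟩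
  have hl' : (l₀ : ℝ) ≤ l := by exact_mod_cast (Nat.le_succ l₀).trans hl
  have h1 : 2 * Real.log C₁ + 16 ≤ C₂ * l := by
    have := (le_max_left _ _).trans (hl₀.trans hl')
    rwa [div_le_iff₀' hC₂] at this
  have h2 : Real.log C₁ + 4 * Real.log 32 ≤ C₂ * l := by
    have := (le_max_right _ _).trans (hl₀.trans hl')
    rwa [div_le_iff₀' hC₂] at this
  -- `t` is the fourth root of the error at scale `l`, and `K = t⁻¹`
  set t : ℝ := Real.exp ((Real.log C₁ - C₂ * l) / 4) with ht
  have ht0 : 0 < t := Real.exp_pos _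
  have ht4 : C₁ * Real.exp (-C₂ * l) = (t ^ 2) ^ 2 := by
    rw [ht, ← pow_mul, ← Real.exp_nat_mul]
    conv_lhs => rw [← Real.exp_log hC₁, ← Real.exp_add]
    congr 1
    push_cast
    ring
  have ht32 : t ≤ 1 / 32 := by
    rw [ht, ← Real.exp_log (by norm_num : (0 : ℝ) < 1 / 32), Real.exp_le_exp,
      Real.log_div one_ne_zero (by norm_num), Real.log_one]
    linarith
  have hlog : Real.log t⁻¹ = (C₂ * l - Real.log C₁) / 4 := by
    rw [Real.log_inv, ht, Real.log_exp]; ring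
  rw [ht4, Real.sqrt_sq (by positivity)]
  refine ⟨by nlinarith [pow_le_one₀ (n := 4) ht0.le (by linarith : t ≤ 1)], t⁻¹, ?_, ?_⟩
  · exact (one_le_inv₀ ht0).2 (by linarith)
  · have h3 : t⁻¹ * (5 * t ^ 2) = 5 * t := by field_simp
    have h4 : 1 / 2 ≤ 1 - 2 * (3 * t ^ 2 + t⁻¹ * (5 * t ^ 2)) := by
      rw [h3]; nlinarith
    have h5 : 0 ≤ Real.log t⁻¹ := Real.log_nonneg ((one_le_inv₀ ht0).2 (by linarith))
    have h6 := mul_le_mul_of_nonneg_left h4 h5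
    rw [hlog] at h6 ⊢
    linarith

variable {φ}

/-- The entropy of the blocks around the two ends of `[x, y)` is smaller than the sum of the
entropies of their inner and outer halves by a multiple of `l`, if `[x, y)` has small spectrum. -/
theorem Factorizes.exists_entropy_decrement {C₁ C₂ : ℝ} (h : φ.Factorizes C₁ C₂) (hC₁ : 0 < C₁)
    (hC₂ : 0 < C₂) : ∃ l₀ : ℕ, 0 < l₀ ∧ ∀ (l : ℕ) (x y : ℤ), l₀ ≤ l → 8 * l < y - x →
      (∀ i, φ.eig (Finset.Ico x y) i ^ 2 ≤ C₁ * Real.exp (-C₂ * l)) →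
      φ.entropy (Finset.Ico (x - l) (x + l) ∪ Finset.Ico (y - l) (y + l)) ≤
        φ.entropy (Finset.Ico x (x + l) ∪ Finset.Ico (y - l) y) +
          φ.entropy (Finset.Ico (x - l) x ∪ Finset.Ico y (y + l)) - C₂ / 16 * l := by
  obtain ⟨l₀, hl₀, H⟩ := exists_log_mul_ge hC₁ hC₂
  refine ⟨l₀, hl₀, fun l x y hl hxy hI => ?_⟩
  obtain ⟨hε1, K, hK, hlog⟩ := H l hl
  obtain ⟨O, R, L, hR, hRp, hLp, hLI, hO, h0, h1, hn⟩ :=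
    h.exists_operators (hl₀.trans_le hl) hxy
  have hd : Disjoint (Finset.Ico x (x + l) ∪ Finset.Ico (y - l) y)
      (Finset.Ico (x - l) x ∪ Finset.Ico y (y + l)) := by
    rw [Finset.disjoint_left]; intro j; simp; omega
  have hu : (Finset.Ico x (x + l) ∪ Finset.Ico (y - l) y) ∪
      (Finset.Ico (x - l) x ∪ Finset.Ico y (y + l)) = endpointWindow x y l := by
    ext j; simp [endpointWindow]; omega
  have h₁ : Finset.Ico x (x + l) ∪ Finset.Ico (y - l) y ⊆ Finset.Ico x y := by
    intro j; simp; omega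
  have h₂ : Disjoint (Finset.Ico x y) (Finset.Ico (x - l) x ∪ Finset.Ico y (y + l)) := by
    rw [Finset.disjoint_left]; intro j; simp; omega
  have := φ.entropy_union_le_of_factorization hd hu h₁ h₂ hO h0 h1 hR hRp hLp hLI
    (by positivity) hε1 hK hn hI
  rw [endpointWindow] at this
  linarith

/-- Hastings' argument: for every sufficiently long interval the density matrix has an eigenvalue
bounded below. Otherwise the mutual information is large at all dyadic scales near the ends of the
interval, and the entropy of two blocks of `2 ^ k * l₀` sites, which would be
`2 ^ k * (O(1) - c * k)`, becomes negative. -/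
theorem Factorizes.exists_eig_ge {C₁ C₂ : ℝ} (h : φ.Factorizes C₁ C₂) (hC₁ : 0 < C₁)
    (hC₂ : 0 < C₂) : ∃ p : ℝ, 0 < p ∧ ∃ n₀ : ℕ, ∀ a b : ℤ, n₀ < b - a →
      ∃ i, p ≤ φ.eig (Finset.Ico a b) i := by
  obtain ⟨l₀, hl₀, H⟩ := h.exists_entropy_decrement hC₁ hC₂
  have hd : (0 : ℝ) < d := by exact_mod_cast NeZero.pos d
  have hd1 : (1 : ℝ) ≤ d := by exact_mod_cast NeZero.pos d
  set A : ℝ := 2 * l₀ * Real.log d + 1 with hA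
  set g : ℝ := C₂ / 32 * l₀ with hg
  have hg0 : 0 < g := by positivity
  obtain ⟨kmax, hk⟩ := exists_nat_gt (A / g)
  rw [div_lt_iff₀ hg0] at hk
  set N : ℕ := 2 ^ kmax * l₀ with hN
  -- shortening an interval by up to `2 * N` sites costs a factor of `d ^ (2 * N)`, and
  -- `C₁ * exp (-C₂ * N)` is a lower bound of the errors at the scales used below
  refine ⟨√(C₁ * Real.exp (-C₂ * N)) / d ^ (2 * N), by positivity, 10 * N, fun a b hab => ?_⟩
  by_contra! hcon
  push_cast at hab
  have hpow : ∀ k ≤ kmax, 2 ^ k * l₀ ≤ N := fun k hk =>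
    Nat.mul_le_mul_right _ (Nat.pow_le_pow_right two_pos hk)
  -- `x` ranges over the first and `y` over the last `N` sites of `[a, b)`
  have key : ∀ k ≤ kmax, ∀ x y : ℤ, a ≤ x → x + (2 ^ k * l₀ : ℕ) ≤ a + N → b - N ≤ y →
      y + (2 ^ k * l₀ : ℕ) ≤ b →
      φ.entropy (Finset.Ico x (x + (2 ^ k * l₀ : ℕ)) ∪ Finset.Ico y (y + (2 ^ k * l₀ : ℕ))) ≤
        2 ^ k * (A - k * g) := by
    intro k
    induction k with
    | zero =>
      intro _ x y _ _ _ _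
      refine (φ.entropy_le_card_mul_log _).trans ?_
      have hc := Finset.card_union_le (Finset.Ico x (x + (2 ^ 0 * l₀ : ℕ)))
        (Finset.Ico y (y + (2 ^ 0 * l₀ : ℕ)))
      have hc' : ((Finset.Ico x (x + (2 ^ 0 * l₀ : ℕ)) ∪
          Finset.Ico y (y + (2 ^ 0 * l₀ : ℕ))).card : ℝ) ≤ 2 * l₀ := by
        simp only [Int.card_Ico] at hc
        have : (Finset.Ico x (x + (2 ^ 0 * l₀ : ℕ)) ∪
          Finset.Ico y (y + (2 ^ 0 * l₀ : ℕ))).card ≤ 2 * l₀ := by omega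
        exact_mod_cast this
      have := mul_le_mul_of_nonneg_right hc' (Real.log_nonneg hd1)
      simp only [pow_zero, one_mul, Nat.cast_zero, zero_mul, sub_zero, hA] at this ⊢
      linarith
    | succ k ih =>
      intro hk x y hx hx' hy hy'
      -- cut both blocks in the middle: the inner halves are the ends of `[x + l, y + l)`
      set l : ℕ := 2 ^ k * l₀ with hl
      have h2l : 2 ^ (k + 1) * l₀ = l + l := by rw [hl, pow_succ]; ring
      rw [h2l] at hx' hy' ⊢
      push_cast at hx' hy' ⊢
      have hlN := hpow (k + 1) hk
      rw [h2l] at hlN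
      have hJI : Finset.Ico (x + l) (y + l) ⊆ Finset.Ico a b := by
        intro j; simp; omega
      have hcard : (Finset.Ico a b \ Finset.Ico (x + l) (y + l)).card ≤ 2 * N := by
        rw [Finset.card_sdiff_of_subset hJI]
        simp only [Int.card_Ico]
        omega
      have hI : ∀ i, φ.eig (Finset.Ico (x + l) (y + l)) i ^ 2 ≤ C₁ * Real.exp (-C₂ * l) := by
        intro i
        have h1 := φ.eig_le_of_subset hJI (fun i => (hcon i).le) i
        have h2 : φ.eig (Finset.Ico (x + l) (y + l)) i ≤ √(C₁ * Real.exp (-C₂ * N)) := by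
          refine h1.trans ?_
          calc _ ≤ (d : ℝ) ^ (2 * N) * (√(C₁ * Real.exp (-C₂ * N)) / d ^ (2 * N)) :=
                mul_le_mul_of_nonneg_right (pow_le_pow_right₀ hd1 hcard) (by positivity)
            _ = _ := by field_simp
        have h3 := pow_le_pow_left₀ (φ.eig_nonneg _ i) h2 2
        rw [Real.sq_sqrt (by positivity)] at h3
        refine h3.trans (mul_le_mul_of_nonneg_left (Real.exp_le_exp.2 ?_) hC₁.le)
        have : (l : ℝ) ≤ N := by exact_mod_cast (by omega : l ≤ N)
        nlinarith
      have hdec := H l (x + l) (y + l) (Nat.le_mul_of_pos_left _ (by positivity)) (by omega) hI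
      have h1 := ih (by omega) x (y + l) (by omega) (by omega) (by omega) (by omega)
      have h2 := ih (by omega) (x + l) y (by omega) (by omega) (by omega) (by omega)
      rw [add_sub_cancel_right, add_sub_cancel_right] at hdec
      rw [← add_assoc, ← add_assoc]
      have hlr : (l : ℝ) = 2 ^ k * l₀ := by rw [hl]; push_cast; ring
      rw [hlr] at hdec
      rw [pow_succ]
      have : C₂ / 16 * (2 ^ k * l₀) = 2 ^ k * 2 * g := by rw [hg]; ring
      linarith
  have hfin := key kmax le_rfl a (b - N) le_rfl (by omega) le_rfl (by omega)
  have hneg : (2 : ℝ) ^ kmax * (A - kmax * g) < 0 :=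
    mul_neg_of_pos_of_neg (by positivity) (by linarith)
  linarith [φ.entropy_nonneg (Finset.Ico a (a + (2 ^ kmax * l₀ : ℕ)) ∪
    Finset.Ico (b - N) (b - N + (2 ^ kmax * l₀ : ℕ)))]

end State

end SpinChain

/-! ### Decay of the spectrum and boundedness of the entropy -/

namespace SpinChain

/-- A distribution that is concentrated, up to exponentially small errors, on sets of exponentially
growing size has bounded entropy: compare it with the weights `c ^ (-N)`, where `N i` is the number
of the sets that miss `i`. -/
theorem sum_negMulLog_le_of_concentrated {ι : Type*} [Fintype ι] {r : ι → ℝ}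
    (hr : ∀ i, 0 ≤ r i) {D : ℕ} (hD : 1 ≤ D) {L n : ℕ} (hn : n ≤ 8 * L + 8)
    (hcard : Fintype.card ι ≤ D ^ n) {S : ℕ → Set ι} {B θ : ℝ} (hB : 0 ≤ B) (hθ0 : 0 ≤ θ)
    (hθ1 : θ < 1) (hS : ∀ l < L, ((S l).ncard : ℝ) ≤ 2 * (D : ℝ) ^ (4 * (l + 1)))
    (hS' : ∀ l < L, ∑ i, (S l)ᶜ.indicator r i ≤ B * θ ^ l) :
    ∑ i, Real.negMulLog (r i) ≤
      B * (1 - θ)⁻¹ * Real.log (4 * (D : ℝ) ^ 8) + 4 * (D : ℝ) ^ 4 + (D : ℝ) ^ 8 := by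
  classical
  have hD1 : (1 : ℝ) ≤ D := by exact_mod_cast hD
  have hD0 : (0 : ℝ) < D := by linarith
  -- `c` beats the growth `D ^ 4` per step of the sets, and `D ^ 8` of the whole index type
  set c : ℝ := 4 * (D : ℝ) ^ 8 with hc
  have hc1 : 1 ≤ c := by
    have := one_le_pow₀ (n := 8) hD1
    linarith
  have hc0 : 0 < c := by linarith
  set N : ι → ℕ := fun i => ((Finset.range L).filter fun l => i ∉ S l).card with hN
  have h1 : ∀ i, Real.negMulLog (r i) ≤ r i * N i * Real.log c + (c ^ N i)⁻¹ := fun i => by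
    have h := negMulLog_le_of_nonneg (hr i) (inv_pos.2 (pow_pos hc0 (N i))) le_rfl
    rw [Real.log_inv, Real.log_pow, Real.log_one] at h
    linarith
  have h2 : ∑ i, r i * N i ≤ B * (1 - θ)⁻¹ := by
    have e1 : ∀ i, r i * N i = ∑ l ∈ Finset.range L, (S l)ᶜ.indicator r i := fun i => by
      simp only [hN]
      rw [Finset.card_filter]
      push_cast
      rw [Finset.mul_sum]
      refine Finset.sum_congr rfl fun l _ => ?_
      by_cases h : i ∈ S l <;> simp [h]
    simp_rw [e1]
    rw [Finset.sum_comm]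
    calc _ ≤ ∑ l ∈ Finset.range L, B * θ ^ l :=
          Finset.sum_le_sum fun l hl => hS' l (Finset.mem_range.1 hl)
      _ ≤ B * (1 - θ)⁻¹ := by
          rw [← Finset.mul_sum, ← tsum_geometric_of_lt_one hθ0 hθ1]
          exact mul_le_mul_of_nonneg_left ((summable_geometric_of_lt_one hθ0 hθ1).sum_le_tsum _
            fun l _ => pow_nonneg hθ0 l) hB
  have h3 : ∀ i, (c ^ N i)⁻¹ ≤
      ∑ l ∈ Finset.range L, (S l).indicator (fun _ => (c ^ l)⁻¹) i + (c ^ L)⁻¹ := fun i => by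
    have hnn : ∀ l, 0 ≤ (S l).indicator (fun _ => (c ^ l)⁻¹) i := fun l =>
      Set.indicator_nonneg (fun _ _ => by positivity) i
    by_cases h : ∃ l, l < L ∧ i ∈ S l
    · obtain ⟨hl, hi⟩ := Nat.find_spec h
      set l := Nat.find h with hldef
      have hlN : l ≤ N i := by
        calc l = (Finset.range l).card := (Finset.card_range l).symm
          _ ≤ N i := Finset.card_le_card fun k hk => by
            have hk' := Finset.mem_range.1 hk
            refine Finset.mem_filter.2 ⟨Finset.mem_range.2 (hk'.trans hl), fun hik => ?_⟩
            exact Nat.find_min h hk' ⟨hk'.trans hl, hik⟩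
      calc (c ^ N i)⁻¹ ≤ (c ^ l)⁻¹ := inv_anti₀ (by positivity) (pow_le_pow_right₀ hc1 hlN)
        _ = (S l).indicator (fun _ => (c ^ l)⁻¹) i := by simp [hi]
        _ ≤ ∑ l ∈ Finset.range L, (S l).indicator (fun _ => (c ^ l)⁻¹) i :=
            Finset.single_le_sum (f := fun l => (S l).indicator (fun _ => (c ^ l)⁻¹) i)
              (fun l _ => hnn l) (Finset.mem_range.2 hl)
        _ ≤ _ := le_add_of_nonneg_right (by positivity)
    · push Not at h
      have hNL : N i = L := by
        rw [hN]
        change ((Finset.range L).filter fun l => i ∉ S l).card = L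
        rw [Finset.filter_true_of_mem fun l hl => h l (Finset.mem_range.1 hl), Finset.card_range]
      rw [hNL]
      exact le_add_of_nonneg_left (Finset.sum_nonneg fun l _ => hnn l)
  have h4 : ∑ i, (c ^ N i)⁻¹ ≤ 4 * (D : ℝ) ^ 4 + (D : ℝ) ^ 8 := by
    calc _ ≤ ∑ i, (∑ l ∈ Finset.range L, (S l).indicator (fun _ => (c ^ l)⁻¹) i + (c ^ L)⁻¹) :=
          Finset.sum_le_sum fun i _ => h3 i
      _ = ∑ l ∈ Finset.range L, (S l).ncard * (c ^ l)⁻¹ + Fintype.card ι * (c ^ L)⁻¹ := by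
          rw [Finset.sum_add_distrib, Finset.sum_comm]
          congr 1
          · refine Finset.sum_congr rfl fun l _ => ?_
            rw [Finset.sum_indicator_eq_sum_filter, Finset.sum_const, nsmul_eq_mul,
              Set.ncard_eq_toFinset_card']
            congr 3
            ext i; simp
          · simp
      _ ≤ ∑ l ∈ Finset.range L, 2 * (D : ℝ) ^ 4 * (1 / 2) ^ l + (D : ℝ) ^ 8 := by
          refine add_le_add (Finset.sum_le_sum fun l hl => ?_) ?_
          · refine (mul_le_mul_of_nonneg_right (hS l (Finset.mem_range.1 hl))
              (by positivity)).trans ?_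
            rw [← div_eq_mul_inv, div_le_iff₀ (by positivity), mul_assoc (2 * (D : ℝ) ^ 4),
              ← mul_pow, mul_add, pow_add, mul_one, mul_comm ((D : ℝ) ^ (4 * l)), ← mul_assoc,
              pow_mul]
            refine mul_le_mul_of_nonneg_left (pow_le_pow_left₀ (by positivity) ?_ l)
              (by positivity)
            have := pow_le_pow_right₀ hD1 (by norm_num : 4 ≤ 8)
            rw [hc]
            nlinarith [pow_pos hD0 8]
          · rw [← div_eq_mul_inv, div_le_iff₀ (by positivity)]
            calc (Fintype.card ι : ℝ) ≤ (D : ℝ) ^ n := by exact_mod_cast hcard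
              _ ≤ (D : ℝ) ^ (8 + 8 * L) := pow_le_pow_right₀ hD1 (by omega)
              _ = (D : ℝ) ^ 8 * ((D : ℝ) ^ 8) ^ L := by rw [pow_add, pow_mul]
              _ ≤ (D : ℝ) ^ 8 * c ^ L := by
                refine mul_le_mul_of_nonneg_left (pow_le_pow_left₀ (by positivity) ?_ L)
                  (by positivity)
                linarith [pow_pos hD0 8]
      _ ≤ _ := by
          rw [← Finset.mul_sum]
          have := (summable_geometric_two).sum_le_tsum (Finset.range L) fun l _ => by positivity
          rw [tsum_geometric_two] at this
          nlinarith [pow_pos hD0 4]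
  calc _ ≤ ∑ i, (r i * N i * Real.log c + (c ^ N i)⁻¹) := Finset.sum_le_sum fun i _ => h1 i
    _ = (∑ i, r i * N i) * Real.log c + ∑ i, (c ^ N i)⁻¹ := by
        rw [Finset.sum_add_distrib, Finset.sum_mul]
    _ ≤ _ := by
        have := mul_le_mul_of_nonneg_right h2 (Real.log_nonneg hc1)
        linarith

theorem sum_norm_sq_starProjection {ι E : Type*} [Fintype ι] [NormedAddCommGroup E]
    [InnerProductSpace ℂ E] [FiniteDimensional ℂ E] (u : OrthonormalBasis ι ℂ E)
    (V : Submodule ℂ E) : ∑ i, ‖V.starProjection (u i)‖ ^ 2 = Module.finrank ℂ V := by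
  set w := stdOrthonormalBasis ℂ V
  have h : ∀ i, ‖V.starProjection (u i)‖ ^ 2 = ∑ k, ‖⟪(w k : E), u i⟫_ℂ‖ ^ 2 := fun i => by
    change ‖V.orthogonalProjectionOnto (u i)‖ ^ 2 = _
    rw [← w.sum_sq_norm_inner_right]
    simp_rw [Submodule.inner_orthogonalProjectionOnto_eq_of_mem_left]
  have hw : ∀ k, ‖(w k : E)‖ = 1 := w.orthonormal.1
  simp_rw [h]
  rw [Finset.sum_comm]
  simp_rw [u.sum_sq_norm_inner_left, hw]
  simp

theorem exists_matrix_starProjection {X : Type*} [Fintype X] [DecidableEq X]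
    (W : Submodule ℂ (EuclideanSpace ℂ X)) :
    ∃ Q : Matrix X X ℂ, IsStarProjection Q ∧ ∀ v, Q.toEuclideanLin v = W.starProjection v := by
  have hQ : IsStarProjection W.starProjection := isStarProjection_starProjection
  set f : Matrix X X ℂ ≃⋆ₐ[ℂ] (EuclideanSpace ℂ X →L[ℂ] EuclideanSpace ℂ X) :=
    Matrix.toEuclideanCLM (n := X) (𝕜 := ℂ) with hf
  obtain ⟨Q, hfQ⟩ := EquivLike.surjective f W.starProjection
  refine ⟨Q, ⟨EquivLike.injective f ?_, EquivLike.injective f ?_⟩, fun v => ?_⟩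
  · rw [map_mul, hfQ, hQ.isIdempotentElem.eq]
  · rw [map_star, hfQ, hQ.isSelfAdjoint.star_eq]
  · rw [← hfQ, ← Matrix.coe_toEuclideanCLM_eq_toEuclideanLin]
    rfl

namespace State

variable {d : ℕ} [NeZero d] (φ : State d)

/-- Acting with `O * R * L` on a vector in the range of the one-dimensional projection
`|u⟩⟨u|` of `𝔄_I` produces a vector of small Schmidt rank with respect to `I`, since only the
sites in the support of `O` contribute. -/
theorem exists_submodule_of_factorization {I Λ₁ Λ₂ Λ : Finset ℤ} (hd : Disjoint Λ₁ Λ₂)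
    (hu : Λ₁ ∪ Λ₂ = Λ) (h₁ : Λ₁ ⊆ I) (h₂ : Disjoint I Λ₂)
    {O R L : φ.gnsSpace →L[ℂ] φ.gnsSpace} (hO : O ∈ φ.repLocal Λ) (hR : R ∈ φ.repLocal I)
    (hL : ∀ N, Commute (φ.rep I N) L) (u : EuclideanSpace ℂ (I → Fin d)) :
    ∃ V : Submodule ℂ (EuclideanSpace ℂ (I → Fin d)), Module.finrank ℂ V ≤ d ^ (2 * Λ₁.card) ∧
      ∀ Q : Matrix (I → Fin d) (I → Fin d) ℂ, (∀ v ∈ V, Q.toEuclideanLin v = 0) → ∀ ψ,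
        φ.rep I Q (O (R (L (φ.rep I (ketBra u u) ψ)))) = 0 := by
  obtain ⟨T, rfl⟩ := (φ.mem_repLocal_iff Λ O).1 hO
  obtain ⟨M, rfl⟩ := (φ.mem_repLocal_iff I R).1 hR
  choose N hN using fun p : (Λ₁ → Fin d) × (Λ₁ → Fin d) =>
    exists_matHom_eq_of_subset h₁ (Matrix.single p.1 p.2 (1 : ℂ))
  refine ⟨Submodule.span ℂ (Set.range fun p => (N p * M).toEuclideanLin u), ?_, fun Q hQ ψ => ?_⟩
  · refine (finrank_range_le_card _).trans_eq ?_
    simp [two_mul, pow_add]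
  · have hcomm : ∀ s t N, Commute (φ.rep I N) (φ.gnsRep (matUnit Λ₂ s t)) := fun s t N =>
      (commute_of_mem_localAlg (Λ₂ := Λ₂) (Finset.disjoint_coe.2 h₂)
        ((mem_localAlg_iff _ _).2 ⟨N, rfl⟩)
        ((mem_localAlg_iff _ _).2 ⟨_, matHom_single _ _ _⟩)).map φ.gnsRep
    have hT : φ.rep Λ T = ∑ s, ∑ t, T s t •
        (φ.rep I (N ((splitConfig hd hu s).1, (splitConfig hd hu t).1)) *
          φ.gnsRep (matUnit Λ₂ (splitConfig hd hu s).2 (splitConfig hd hu t).2)) := by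
      rw [rep_apply, matHom_apply]
      simp_rw [map_sum, map_smul, rep_apply, hN, matHom_single, ← map_mul, ← matUnit_split hd hu]
    simp_rw [← mul_apply_eq_comp]
    rw [hT]
    simp_rw [Finset.sum_mul, Finset.mul_sum, smul_mul_assoc, mul_smul_comm]
    simp_rw [sum_apply, smul_apply]
    refine Finset.sum_eq_zero fun s _ => Finset.sum_eq_zero fun t _ => ?_
    set y := φ.gnsRep (matUnit Λ₂ (splitConfig hd hu s).2 (splitConfig hd hu t).2) with hy
    set p := ((splitConfig hd hu s).1, (splitConfig hd hu t).1) with hp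
    -- move all factors which commute with `𝔄_I` to the right
    have e : φ.rep I Q * (φ.rep I (N p) * y * (φ.rep I M * (L * φ.rep I (ketBra u u)))) =
        φ.rep I (Q * (N p * M) * ketBra u u) * (y * L) := by
      have hyc : ∀ A, Commute (φ.rep I A) y := hcomm _ _
      simp only [map_mul, mul_assoc]
      rw [← (hL _).eq, ← mul_assoc y, ← (hyc M).eq, mul_assoc, ← mul_assoc y, ← (hyc _).eq,
        mul_assoc]
    have e2 : Q * (N p * M) * ketBra u u = 0 := by
      rw [mul_assoc, mul_ketBra, mul_ketBra, hQ _ (Submodule.subset_span ⟨p, rfl⟩)]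
      ext; simp [ketBra_apply]
    rw [e, e2]
    simp

variable {φ}

/-- At scale `l` the spectral distribution of the density matrix of a long interval is
concentrated, up to an exponentially small error, on a set of size `2 * d ^ (4 * l)`. -/
theorem Factorizes.exists_concentrated {C₁ C₂ : ℝ} (h : φ.Factorizes C₁ C₂) {x y : ℤ} {l : ℕ}
    (hl : 0 < l) (hxy : 8 * l < y - x) {I : Finset ℤ} (hI : I = Finset.Ico x y)
    {p : ℝ} (hp : 0 < p) {i₀ : I → Fin d} (hi₀ : p ≤ φ.eig I i₀) :
    ∃ S : Set (I → Fin d), (S.ncard : ℝ) ≤ 2 * (d : ℝ) ^ (4 * l) ∧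
      ∑ i, Sᶜ.indicator (φ.eig I) i ≤
        2 * ((C₁ * Real.exp (-C₂ * l)) ^ 2 / p) := by
  classical
  obtain ⟨O, R, L, hR, hRp, hLp, hLI, hO, h0, h1, hn⟩ := h.exists_operators hl hxy
  have hd : Disjoint (Finset.Ico x (x + l) ∪ Finset.Ico (y - l) y)
      (Finset.Ico (x - l) x ∪ Finset.Ico y (y + l)) := by
    rw [Finset.disjoint_left]; intro j; simp; omega
  have hu : (Finset.Ico x (x + l) ∪ Finset.Ico (y - l) y) ∪
      (Finset.Ico (x - l) x ∪ Finset.Ico y (y + l)) = endpointWindow x y l := by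
    ext j; simp [endpointWindow]; omega
  have h₁ : Finset.Ico x (x + l) ∪ Finset.Ico (y - l) y ⊆ Finset.Ico x y := by
    intro j; simp; omega
  have h₂ : Disjoint (Finset.Ico x y) (Finset.Ico (x - l) x ∪ Finset.Ico y (y + l)) := by
    rw [Finset.disjoint_left]; intro j; simp; omega
  rw [← hI] at hR hLI h₁ h₂
  set u := φ.eigBasis I with hu'
  set ε := C₁ * Real.exp (-C₂ * l) with hε
  obtain ⟨V, hV, hQV⟩ := φ.exists_submodule_of_factorization hd hu h₁ h₂ hO hR hLI (u i₀)
  have hVcard : (Module.finrank ℂ V : ℝ) ≤ (d : ℝ) ^ (4 * l) := by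
    have hc := Finset.card_union_le (Finset.Ico x (x + l)) (Finset.Ico (y - l) y)
    simp only [Int.card_Ico] at hc
    have : Module.finrank ℂ V ≤ d ^ (4 * l) :=
      hV.trans (Nat.pow_le_pow_right (NeZero.pos d) (by omega))
    exact_mod_cast this
  -- `Q` is the matrix of the projection onto the orthogonal complement of `V`
  obtain ⟨Q, hQp, hQapp⟩ := exists_matrix_starProjection Vᗮ
  set Ψ := φ.rep I (ketBra (u i₀) (u i₀)) φ.gnsVec with hΨ
  set lam := φ.eig I i₀ with hlam
  have hlam0 : 0 < lam := hp.trans_le hi₀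
  have hproj : IsStarProjection (φ.rep I (ketBra (u i₀) (u i₀))) := by
    refine IsStarProjection.map ⟨?_, star_ketBra _ _⟩ (φ.rep I)
    rw [IsIdempotentElem, ketBra_mul_ketBra, inner_self_eq_ofReal, u.orthonormal.1]
    simp
  have hΨΩ : ⟪φ.gnsVec, Ψ⟫_ℂ = lam := by
    rw [hΨ, inner_rep, toPos_ketBra_eigBasis, if_pos rfl]
  have hΨn : ‖Ψ‖ ^ 2 = lam := by
    have := hproj.norm_sq_apply φ.gnsVec
    rw [← hΨ, hΨΩ] at this
    exact_mod_cast this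
  -- `Q` annihilates `O * R * L * Ψ`, which is close to `lam • Ω`
  have hQΩ : ‖φ.rep I Q φ.gnsVec‖ ^ 2 ≤ ε ^ 2 / p := by
    have e1 := (O * R * L - φ.groundProj).le_of_opNorm_le hn Ψ
    rw [sub_apply, groundProj, InnerProductSpace.rankOne_apply, hΨΩ] at e1
    have e2 : φ.rep I Q ((O * R * L) Ψ) = 0 := hQV Q (fun v hv => by
      rw [hQapp]
      exact (Submodule.starProjection_apply_eq_zero_iff _).2
        (Submodule.le_orthogonal_orthogonal V hv)) φ.gnsVec
    have hQrep : IsStarProjection (φ.rep I Q) := hQp.map (φ.rep I)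
    have e3 := hQrep.norm_apply_le ((O * R * L) Ψ - (lam : ℂ) • φ.gnsVec)
    rw [map_sub, e2, zero_sub, norm_neg, map_smul, norm_smul, Complex.norm_real,
      Real.norm_of_nonneg hlam0.le] at e3
    have e4 := pow_le_pow_left₀ (by positivity) (e3.trans e1) 2
    rw [mul_pow, mul_pow, hΨn] at e4
    rw [le_div_iff₀ hp]
    have e5 : lam * ‖φ.rep I Q φ.gnsVec‖ ^ 2 ≤ ε ^ 2 := by
      refine le_of_mul_le_mul_left ?_ hlam0
      linarith
    nlinarith [sq_nonneg ‖φ.rep I Q φ.gnsVec‖]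
  -- the average of `a` under the spectral distribution is small, while `1 - a` sums to `dim V`;
  -- the set where `a ≤ 1 / 2` is then as required, by Markov's inequality
  set a : (I → Fin d) → ℝ := fun i => ‖Vᗮ.starProjection (u i)‖ ^ 2 with ha
  have ha0 : ∀ i, 0 ≤ a i := fun i => by positivity
  have hsum : ∀ i, ‖V.starProjection (u i)‖ ^ 2 = 1 - a i := fun i => by
    have := V.norm_sq_eq_add_norm_sq_projection (u i)
    rw [u.orthonormal.1] at this
    simp only [ha, Submodule.starProjection_apply, Submodule.coe_norm] at this ⊢
    linarith
  have hφQ : ∑ i, φ.eig I i * a i ≤ ε ^ 2 / p := by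
    refine Eq.trans_le ?_ hQΩ
    have e1 : ((‖φ.rep I Q φ.gnsVec‖ ^ 2 : ℝ) : ℂ) = ((∑ i, φ.eig I i * a i : ℝ) : ℂ) := by
      rw [(hQp.map (φ.rep I)).norm_sq_apply, inner_rep, toPos_matHom_eq_sum_eig]
      push_cast
      refine Finset.sum_congr rfl fun i _ => ?_
      rw [hQapp, ← isStarProjection_starProjection.norm_sq_apply]
    exact (Complex.ofReal_injective e1).symm
  refine ⟨{i | a i ≤ 1 / 2}, ?_, ?_⟩
  · calc _ = ∑ i, Set.indicator {i | a i ≤ 1 / 2} (fun _ => (1 : ℝ)) i := by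
          rw [Finset.sum_indicator_eq_sum_filter, Finset.sum_const, nsmul_eq_mul, mul_one,
            Set.ncard_eq_toFinset_card']
          congr 2
          ext i; simp
      _ ≤ ∑ i, 2 * ‖V.starProjection (u i)‖ ^ 2 := by
          refine Finset.sum_le_sum fun i _ => ?_
          by_cases hi : a i ≤ 1 / 2
          · rw [Set.indicator_of_mem (by exact hi), hsum]; linarith
          · rw [Set.indicator_of_notMem (by exact hi)]; positivity
      _ ≤ _ := by
          rw [← Finset.mul_sum, sum_norm_sq_starProjection]
          linarith
  · calc _ ≤ ∑ i, 2 * (φ.eig I i * a i) := by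
          refine Finset.sum_le_sum fun i _ => ?_
          have hei := φ.eig_nonneg I i
          by_cases hi : a i ≤ 1 / 2
          · rw [Set.indicator_of_notMem (by simpa using hi)]
            have := mul_nonneg hei (ha0 i)
            linarith
          · rw [Set.indicator_of_mem (by exact hi)]
            nlinarith
      _ ≤ _ := by
          rw [← Finset.mul_sum]
          linarith

/-- The entropies of all intervals are bounded. Short intervals are covered by the dimension
bound. -/
theorem Factorizes.exists_entropy_le {C₁ C₂ : ℝ} (h : φ.Factorizes C₁ C₂) (hC₁ : 0 < C₁)
    (hC₂ : 0 < C₂) : ∃ S : ℝ, ∀ a b : ℤ, φ.entropy (Finset.Ico a b) ≤ S := by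
  obtain ⟨p, hp, n₀, H⟩ := h.exists_eig_ge hC₁ hC₂
  set θ := Real.exp (-C₂) ^ 2 with hθ
  have hθ1 : θ < 1 :=
    pow_lt_one₀ (Real.exp_pos _).le (Real.exp_lt_one_iff.2 (by linarith)) two_ne_zero
  set B : ℝ := 2 * (C₁ ^ 2 / p) with hB
  refine ⟨max (n₀ * Real.log d + 1)
    (B * (1 - θ)⁻¹ * Real.log (4 * (d : ℝ) ^ 8) + 4 * (d : ℝ) ^ 4 + (d : ℝ) ^ 8), fun a b => ?_⟩
  rcases le_or_gt (b - a) n₀ with hab | hab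
  · refine (φ.entropy_le_card_mul_log _).trans (le_max_of_le_left ?_)
    have hc : (Finset.Ico a b).card ≤ n₀ := by rw [Int.card_Ico]; omega
    have hc' : ((Finset.Ico a b).card : ℝ) ≤ n₀ := by exact_mod_cast hc
    have hd1 : (1 : ℝ) ≤ d := by exact_mod_cast NeZero.pos d
    linarith [mul_le_mul_of_nonneg_right hc' (Real.log_nonneg hd1)]
  · obtain ⟨i₀, hi₀⟩ := H a b hab
    refine le_max_of_le_right ?_
    obtain ⟨n, rfl⟩ : ∃ n : ℕ, b = a + n := ⟨(b - a).toNat, by omega⟩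
    have key : ∀ l : ℕ, ∃ S : Set ((Finset.Ico a (a + n)) → Fin d), l < (n - 1) / 8 →
        (S.ncard : ℝ) ≤ 2 * (d : ℝ) ^ (4 * (l + 1)) ∧
          ∑ i, Sᶜ.indicator (φ.eig (Finset.Ico a (a + n))) i ≤ B * θ ^ l := fun l => by
      by_cases hl : l < (n - 1) / 8
      · obtain ⟨S, hS, hS'⟩ := h.exists_concentrated (x := a) (y := a + n) l.succ_pos
          (by push_cast; omega) rfl hp hi₀
        refine ⟨S, fun _ => ⟨hS, hS'.trans ?_⟩⟩
        have e : Real.exp (-C₂ * (l.succ : ℕ)) = Real.exp (-C₂) ^ (l + 1) := by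
          rw [← Real.exp_nat_mul]; congr 1; push_cast; ring
        have e2 : (C₁ * Real.exp (-C₂) ^ (l + 1)) ^ 2 = C₁ ^ 2 * θ ^ l * θ := by rw [hθ]; ring
        rw [e, e2, hB]
        calc 2 * (C₁ ^ 2 * θ ^ l * θ / p) = 2 * (C₁ ^ 2 / p) * θ ^ l * θ := by ring
          _ ≤ 2 * (C₁ ^ 2 / p) * θ ^ l := mul_le_of_le_one_right (by positivity) hθ1.le
      · exact ⟨∅, fun h => absurd h hl⟩
    choose S hS using key
    rw [entropy_eq]
    exact sum_negMulLog_le_of_concentrated (φ.eig_nonneg _) (NeZero.pos d) (L := (n - 1) / 8)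
      (n := n) (by omega) (by simp) (by positivity) (by positivity) hθ1 (fun l hl => (hS l hl).1)
      fun l hl => (hS l hl).2

end State

end SpinChain

end

theorem mainTheorem7 (d : ℕ) [NeZero d] (φ : SpinChain.State d)
    (C₁ C₂ : ℝ) (hC₁ : 0 < C₁) (hC₂ : 0 < C₂)
    (hfact : ∀ (m : ℤ) (n l : ℕ), 0 < l → 8 * l < n →
      ∃ O_B O_R O_L : φ.gnsSpace →L[ℂ] φ.gnsSpace,
        O_R ∈ φ.repLocal (Set.Icc m (m + n - 1)) ∧ IsStarProjection O_R ∧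
        O_L ∈ φ.repVN (Set.Icc m (m + n - 1))ᶜ ∧ IsStarProjection O_L ∧
        O_B ∈ φ.repLocal (Set.Ioo (m - l) (m + l) ∪ Set.Ioo (m + n - l) (m + n + l)) ∧
        0 ≤ O_B ∧ O_B ≤ 1 ∧
        ‖O_B * O_R * O_L - φ.groundProj‖ ≤ C₁ * Real.exp (-C₂ * l)) :
    (∃ S : ℝ, ∀ a b : ℤ, φ.entropy (Finset.Icc a b) ≤ S) ∧
      BddAbove (Set.range fun n : ℕ => φ.entropy (Finset.Icc 1 (n : ℤ))) := by
  have h : φ.Factorizes C₁ C₂ := hfact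
  obtain ⟨S, hS⟩ := h.exists_entropy_le hC₁ hC₂
  have hS' : ∀ a b : ℤ, φ.entropy (Finset.Icc a b) ≤ S := fun a b => by
    have e : Finset.Icc a b = Finset.Ico a (b + 1) := by ext j; simp
    rw [e]
    exact hS a (b + 1)
  refine ⟨⟨S, hS'⟩, S, ?_⟩
  rintro _ ⟨n, rfl⟩
  exact hS' 1 n
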